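/- **Setting.** Let $\mathbb T\subset\mathbb C$ be the unit circle, with normalized arc length measure, $L^2=L^2(\mathbb T)$, $H^2\subset L^2$ the Hardy space and $\mathbb P:L^2\to H^2$ the orthogonal (Riesz) projection. $\mathrm{Rat}(\mathbb T)$ is the set of complex rational functions whose poles in $\mathbb C$ all lie on $\mathbb T$, and $\mathrm{Rat}_0(\mathbb T)$ is the set of strictly proper functions in it. For $\omega\in\mathrm{Rat}(\mathbb T)$, the operator $T_\omega\,(H^2\to H^2)$ is defined by $$\mathrm{Dom}(T_\omega)=\{g\in H^2 : \omega g=f+\rho \text{ with } f\in L^2,\ \rho\in\mathrm{Rat}_0(\mathbb T)\},\qquad T_\omega g=\mathbb P f,$$ and $T_\omega^*$ is its Hilbert space adjoint. An operator $A$ is symmetric if it is densely defined and $\langle Ax,y\rangle=\langle x,Ay\rangle$ for all $x,y\in\mathrm{Dom}(A)$. Put $\omega(\mathbb T)=\{\omega(z): z\in\mathbb T,\ z\text{ not a pole of }\omega\}$. The essential spectrum $\sigma_{\mathrm{ess}}(T_\omega)$ is the set of $\lambda\in\mathbb C$ for which $T_\omega-\lambda I$ is not Fredholm; here a Fredholm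 operator is a closed operator with finite dimensional kernel and closed range of finite codimension. For a polynomial $r$ of degree $k$ let $r^\sharp(z)=z^k\,\overline{r(1/\overline z)}$; a polynomial $r\neq0$ is self-inversive if $r=\gamma r^\sharp$ for some constant $\gamma\in\mathbb C$. **Theorem.** Let $\omega=s/q\in\mathrm{Rat}(\mathbb T)$ with $s,q$ co-prime complex polynomials, $q\ne0$. Write $s(z)=\sum_{k=0}^n s_kz^k$ and $q(z)=\sum_{k=0}^m q_kz^k$ with $n=\deg s$, $m=\deg q$. The following are equivalent. 1. $T_\omega^*$ is symmetric. 2. $\omega(\mathbb T)\subset\mathbb R$. 3. $\omega(z)=\widetilde\omega\left(-i\,\frac{z+1}{z-1}\right)$ for a rational function $\widetilde\omega$ with real coefficients whose poles in $\mathbb C$ all lie on $\mathbb R$. 4. $\sigma_{\mathrm{ess}}(T_\omega)\subset\mathbb R$. 5. Either $s=0$, or $\omega$ is proper (that is, $n\le m$), $s=z^{m-n}\widetilde s$ with $\widetilde s$ a self-inversive polynomial, and $q_0\overline{s_n}=\overline{q_m}\,s_{m-n}$. Moreover, if $T_\omega^*$ is symmetric, then $T_\omega^*\subset T_\omega$,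 that is, $T_\omega$ extends $T_\omega^*$. -/

import Mathlib

open MeasureTheory Polynomial ComplexConjugate

noncomputable section

namespace ToeplitzLike

/-! ### The Hardy space `H²` of the unit circle -/

/-- `L²` of the unit circle with respect to normalized arc length. The circle is parametrized by
`UnitAddCircle = ℝ / ℤ` through `t ↦ exp (2 π i t)`, see `pt`. -/
abbrev L2 : Type := Lp ℂ 2 (@AddCircle.haarAddCircle (1 : ℝ) _)

/-- The point `z = exp (2 π i t)` of the unit circle. -/
def pt (t : UnitAddCircle) : ℂ := (AddCircle.toCircle t : ℂ)

/-- The Hardy space `H²`: the functions in `L²` of the circle whose Fourier coefficients of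
negative index vanish. -/
def H2 : Submodule ℂ L2 where
  carrier := {f | ∀ n : ℤ, n < 0 → fourierCoeff (f : UnitAddCircle → ℂ) n = 0}
  zero_mem' := by
    intro n _
    rw [← fourierBasis_repr]
    simp
  add_mem' := by
    intro f g hf hg n hn
    have h1 := hf n hn
    have h2 := hg n hn
    rw [← fourierBasis_repr] at h1 h2 ⊢
    simp [h1, h2]
  smul_mem' := by
    intro c f hf n hn
    have h1 := hf n hn
    rw [← fourierBasis_repr] at h1 ⊢
    simp [h1]

theorem isClosed_H2 : IsClosed (H2 : Set L2) := by
  have : (H2 : Set L2) = ⋂ n : ℤ, ⋂ _ : n < 0, {f : L2 | fourierBasis.repr f n = 0} := by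
    ext f
    simp only [Set.mem_iInter, Set.mem_ofPred_eq, SetLike.mem_coe, fourierBasis_repr]
    rfl
  rw [this]
  refine isClosed_iInter fun n => isClosed_iInter fun _ => ?_
  refine isClosed_eq ?_ continuous_const
  have h : Continuous fun f : L2 => inner ℂ (fourierBasis n : L2) f := by fun_prop
  convert h using 2 with f
  rw [HilbertBasis.repr_apply_apply]

instance : CompleteSpace H2 := isClosed_H2.completeSpace_coe

/-- The Riesz projection `ℙ` of `L²` onto `H²`, that is, the orthogonal projection. -/
def rieszProj : L2 →L[ℂ] H2 := H2.orthogonalProjectionOnto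

/-! ### Rational functions -/

/-- The value of a rational function at a complex number that is not a pole. -/
def val (ω : RatFunc ℂ) (z : ℂ) : ℂ := ω.eval (RingHom.id ℂ) z

/-- `z` is a pole of the rational function `ω` (`RatFunc.denom` is the denominator of `ω` in
lowest terms). -/
def IsPole (ω : RatFunc ℂ) (z : ℂ) : Prop := ω.denom.eval z = 0

/-- `Rat(𝕋)`: the rational functions all of whose poles in `ℂ` lie on the unit circle. -/
def RatT : Set (RatFunc ℂ) := {ω | ∀ z, IsPole ω z → ‖z‖ = 1}

/-- A rational function is strictly proper if its numerator has smaller degree than its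
denominator. -/
def StrictlyProper (ω : RatFunc ℂ) : Prop := ω.num.degree < ω.denom.degree

/-- `Rat₀(𝕋)`: the strictly proper rational functions in `Rat(𝕋)`. -/
def Rat0T : Set (RatFunc ℂ) := {ω | ω ∈ RatT ∧ StrictlyProper ω}

/-- `ω(𝕋)`: the set of values of `ω` on the unit circle, poles excluded. -/
def circleImage (ω : RatFunc ℂ) : Set ℂ := {w | ∃ z : ℂ, ‖z‖ = 1 ∧ ¬ IsPole ω z ∧ val ω z = w}

theorem val_add {ρ τ : RatFunc ℂ} {z : ℂ} (h1 : ¬ IsPole ρ z) (h2 : ¬ IsPole τ z) :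
    val (ρ + τ) z = val ρ z + val τ z := by
  apply RatFunc.eval_add
  · simpa [IsPole, Polynomial.eval₂_id] using h1
  · simpa [IsPole, Polynomial.eval₂_id] using h2

theorem strictlyProper_iff {ρ : RatFunc ℂ} {a b : ℂ[X]} (hb : b ≠ 0)
    (h : a * ρ.denom = ρ.num * b) : StrictlyProper ρ ↔ a.degree < b.degree := by
  have h1 := congrArg Polynomial.degree h
  rw [degree_mul, degree_mul] at h1
  have hd : ρ.denom.degree = (ρ.denom.natDegree : WithBot ℕ) := degree_eq_natDegree ρ.denom_ne_zero
  have hb' : b.degree = (b.natDegree : WithBot ℕ) := degree_eq_natDegree hb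
  unfold StrictlyProper
  rw [hd, hb'] at h1 ⊢
  by_cases hn : ρ.num = 0
  · have ha : a = 0 := by
      have := h
      rw [hn, zero_mul] at this
      exact (mul_eq_zero.mp this).resolve_right ρ.denom_ne_zero
    simp [hn, ha]
  · have ha : a ≠ 0 := by
      rintro rfl
      rw [zero_mul] at h
      exact (mul_ne_zero hn hb) h.symm
    rw [degree_eq_natDegree hn, degree_eq_natDegree ha] at h1 ⊢
    have h2 : ((a.natDegree + ρ.denom.natDegree : ℕ) : WithBot ℕ) =
        ((ρ.num.natDegree + b.natDegree : ℕ) : WithBot ℕ) := by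
      push_cast
      exact h1
    rw [Nat.cast_inj] at h2
    rw [Nat.cast_lt, Nat.cast_lt]
    omega

theorem zero_mem_Rat0T : (0 : RatFunc ℂ) ∈ Rat0T := by
  constructor
  · intro z hz
    simp [IsPole] at hz
  · simp [StrictlyProper]

theorem add_mem_Rat0T {ρ τ : RatFunc ℂ} (hρ : ρ ∈ Rat0T) (hτ : τ ∈ Rat0T) : ρ + τ ∈ Rat0T := by
  constructor
  · intro z hz
    have h := Polynomial.eval₂_eq_zero_of_dvd_of_eval₂_eq_zero (RingHom.id ℂ) z
      (RatFunc.denom_add_dvd ρ τ) (by simpa [IsPole, Polynomial.eval₂_id] using hz)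
    rw [Polynomial.eval₂_id, Polynomial.eval_mul, mul_eq_zero] at h
    exact h.elim (hρ.1 z) (hτ.1 z)
  · have hb : ρ.denom * τ.denom ≠ 0 := mul_ne_zero ρ.denom_ne_zero τ.denom_ne_zero
    rw [strictlyProper_iff hb (RatFunc.num_denom_add ρ τ).symm]
    have h1 : ρ.num.degree < ρ.denom.degree := hρ.2
    have h2 : τ.num.degree < τ.denom.degree := hτ.2
    refine lt_of_le_of_lt (degree_add_le _ _) (max_lt ?_ ?_)
    · rw [degree_mul, degree_mul]
      exact WithBot.add_lt_add_right (by simpa using τ.denom_ne_zero) h1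
    · rw [degree_mul, degree_mul]
      exact WithBot.add_lt_add_left (by simpa using ρ.denom_ne_zero) h2

theorem C_mul_mem_Rat0T (c : ℂ) {ρ : RatFunc ℂ} (hρ : ρ ∈ Rat0T) : RatFunc.C c * ρ ∈ Rat0T := by
  have key : (RatFunc.C c * ρ).num * ρ.denom = (C c * ρ.num) * (RatFunc.C c * ρ).denom := by
    have := RatFunc.num_denom_mul (RatFunc.C c) ρ
    simpa using this
  constructor
  · intro z hz
    have h := Polynomial.eval₂_eq_zero_of_dvd_of_eval₂_eq_zero (RingHom.id ℂ) z
      (RatFunc.denom_mul_dvd (RatFunc.C c) ρ) (by simpa [IsPole, Polynomial.eval₂_id] using hz)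
    apply hρ.1 z
    simpa [IsPole, Polynomial.eval₂_id] using h
  · rw [strictlyProper_iff ρ.denom_ne_zero key.symm]
    have h1 : ρ.num.degree < ρ.denom.degree := hρ.2
    refine lt_of_le_of_lt ?_ h1
    by_cases hc : c = 0
    · simp [hc]
    · rw [degree_mul, degree_C hc, zero_add]

theorem val_C_mul (c : ℂ) {ρ : RatFunc ℂ} {z : ℂ} (h : ¬ IsPole ρ z) :
    val (RatFunc.C c * ρ) z = c * val ρ z := by
  unfold val
  rw [RatFunc.eval_mul]
  · simp
  · simp
  · simpa [IsPole, Polynomial.eval₂_id] using h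

theorem ae_not_isPole (ρ : RatFunc ℂ) :
    ∀ᵐ t ∂(@AddCircle.haarAddCircle (1 : ℝ) _), ¬ IsPole ρ (pt t) := by
  have hfin : {t : UnitAddCircle | IsPole ρ (pt t)}.Finite := by
    have h : {z : ℂ | IsPole ρ z}.Finite := by
      refine (ρ.denom.roots.toFinset.finite_toSet).subset fun z hz => ?_
      simpa [ρ.denom_ne_zero, IsPole] using hz
    refine Set.Finite.preimage (f := pt) (fun a _ b _ hab => ?_) h
    exact AddCircle.injective_toCircle one_ne_zero (Subtype.ext hab)
  have : AddCircle.haarAddCircle {t : UnitAddCircle | IsPole ρ (pt t)} = 0 := by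
    have : NullSingletonClass (volume : Measure UnitAddCircle) := ⟨fun x => by
      rw [← Metric.closedBall_zero, AddCircle.volume_closedBall]
      simp⟩
    have h0 : volume {t : UnitAddCircle | IsPole ρ (pt t)} = 0 := hfin.measure_zero _
    rw [AddCircle.volume_eq_smul_haarAddCircle] at h0
    simpa using h0
  rw [ae_iff]
  simpa using this

/-! ### The Toeplitz-like operator -/

/-- A square integrable function does not solve `(z - α) u = 1` on the circle if `|α| = 1`. -/
theorem no_L2_inverse {α : ℂ} (hα : ‖α‖ = 1) (u : L2)
    (h : ∀ᵐ t ∂(@AddCircle.haarAddCircle (1 : ℝ) _), (pt t - α) * u t = 1) : False := by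
  set c : ℤ → ℂ := fun n => fourierCoeff (u : UnitAddCircle → ℂ) n with hc
  have hu : Integrable (u : UnitAddCircle → ℂ) AddCircle.haarAddCircle :=
    (Lp.memLp u).integrable (by norm_num)
  have hi : ∀ n : ℤ, Integrable (fun t => fourier n t * (u : UnitAddCircle → ℂ) t)
      AddCircle.haarAddCircle := fun n => hu.fourier_smul n
  have hrec : ∀ n : ℤ, c (n - 1) - α * c n = if n = 0 then 1 else 0 := by
    intro n
    have h1 : fourierCoeff (fourier 0 : UnitAddCircle → ℂ) n = if n = 0 then 1 else 0 := by
      rw [fourierCoeff_fourier]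
      simp [Pi.single_apply]
    rw [← h1]
    simp only [hc, fourierCoeff]
    rw [← integral_const_mul, ← integral_sub]
    · apply integral_congr_ae
      filter_upwards [h] with t ht
      have h2 : (fourier (-(n - 1)) t : ℂ) = fourier (-n) t * pt t := by
        rw [show -(n - 1) = -n + 1 by ring, fourier_add, fourier_one]
        rfl
      simp only [smul_eq_mul, h2, fourier_zero]
      rw [← ht]
      ring
    · exact hi _
    · exact (hi _).const_mul _
  have hsum : Summable fun n : ℤ => ‖c n‖ ^ 2 := (hasSum_sq_fourierCoeff u).summable
  have hpos : ∀ n : ℕ, ‖c n‖ = ‖c 0‖ := by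
    intro n
    induction n with
    | zero => rfl
    | succ k ih =>
      have h1 := hrec ((k : ℤ) + 1)
      rw [if_neg (by omega), add_sub_cancel_right, sub_eq_zero] at h1
      rw [← ih, h1, norm_mul, hα, one_mul]
      push_cast
      rfl
  have hneg : ∀ n : ℕ, ‖c (-1 - n)‖ = ‖c (-1)‖ := by
    intro n
    induction n with
    | zero => simp
    | succ k ih =>
      have h1 := hrec (-1 - k)
      rw [if_neg (by omega), sub_eq_zero] at h1
      rw [← ih, ← one_mul ‖c (-1 - k)‖, ← hα, ← norm_mul, ← h1]
      congr 2
      push_cast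
      ring
  have h0 : ‖c 0‖ = 0 := by
    have h1 := (hsum.comp_injective Nat.cast_injective).tendsto_atTop_zero
    simp only [Function.comp_def, hpos] at h1
    simpa using tendsto_nhds_unique tendsto_const_nhds h1
  have h1 : ‖c (-1)‖ = 0 := by
    have hinj : Function.Injective (fun n : ℕ => (-1 - n : ℤ)) := fun a b hab => by
      simpa using hab
    have h1 := (hsum.comp_injective hinj).tendsto_atTop_zero
    simp only [Function.comp_def, hneg] at h1
    simpa using tendsto_nhds_unique tendsto_const_nhds h1
  have h2 := hrec 0
  rw [norm_eq_zero] at h0 h1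
  simp [h0, h1] at h2

theorem continuous_pt : Continuous pt := continuous_subtype_val.comp AddCircle.continuous_toCircle

theorem memLp_continuous_mul {w : UnitAddCircle → ℂ} (hw : Continuous w) (f : L2) :
    MemLp (fun t => w t * f t) 2 (@AddCircle.haarAddCircle (1 : ℝ) _) := by
  have h : MemLp w ⊤ (@AddCircle.haarAddCircle (1 : ℝ) _) := by
    obtain ⟨C, hC⟩ := isCompact_univ.exists_bound_of_continuousOn hw.continuousOn
    exact memLp_top_of_bound hw.aestronglyMeasurable C (.of_forall fun t => hC t trivial)
  exact (Lp.memLp f).mul' h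

/-- A function in `Rat₀(𝕋)` that is square integrable on the circle is zero. -/
theorem eq_zero_of_ae_eq {ρ : RatFunc ℂ} (hρ : ρ ∈ Rat0T) (f : L2)
    (h : ∀ᵐ t ∂(@AddCircle.haarAddCircle (1 : ℝ) _), val ρ (pt t) = f t) : ρ = 0 := by
  by_contra h0
  have hnum : ρ.num ≠ 0 := by simpa using h0
  have hdeg : 0 < ρ.denom.degree := lt_of_le_of_lt (zero_le_degree_iff.mpr hnum) hρ.2
  obtain ⟨α, hα⟩ := Complex.exists_root hdeg
  obtain ⟨d, hd⟩ := dvd_iff_isRoot.mpr hα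
  have hα1 : ‖α‖ = 1 := hρ.1 α hα
  have hb : ρ.num.eval α ≠ 0 := by
    intro hb
    obtain ⟨a, b, hab⟩ := ρ.isCoprime_num_denom
    have h1 := congrArg (Polynomial.eval α) hab
    rw [eval_add, eval_mul, eval_mul, hb, hα.eq_zero] at h1
    simp at h1
  obtain ⟨w, hw⟩ : X - C α ∣ ρ.num - C (ρ.num.eval α) := by
    rw [dvd_iff_isRoot]
    simp
  set b := ρ.num.eval α with hbdef
  -- the function `(d f - w) / b` inverts `z - α`
  have hc1 : Continuous fun t => b⁻¹ * d.eval (pt t) :=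
    continuous_const.mul (d.continuous.comp continuous_pt)
  have hc2 : Continuous fun t => b⁻¹ * w.eval (pt t) :=
    continuous_const.mul (w.continuous.comp continuous_pt)
  have hm2 : MemLp (fun t => b⁻¹ * w.eval (pt t)) 2 (@AddCircle.haarAddCircle (1 : ℝ) _) := by
    obtain ⟨C, hC⟩ := isCompact_univ.exists_bound_of_continuousOn hc2.continuousOn
    exact MemLp.of_bound hc2.aestronglyMeasurable C (.of_forall fun t => hC t trivial)
  have hm := (memLp_continuous_mul hc1 f).sub hm2
  refine no_L2_inverse hα1 (hm.toLp _) ?_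
  filter_upwards [hm.coeFn_toLp, h, ae_not_isPole ρ] with t h1 h2 h3
  rw [h1, Pi.sub_apply, ← h2]
  have h4 : val ρ (pt t) * ((pt t - α) * d.eval (pt t)) = ρ.num.eval (pt t) := by
    have h5 : ρ.denom.eval (pt t) = (pt t - α) * d.eval (pt t) := by
      rw [hd]
      simp
    rw [← h5]
    unfold val RatFunc.eval
    rw [eval₂_id, eval₂_id]
    exact div_mul_cancel₀ _ h3
  have h6 : ρ.num.eval (pt t) - b = (pt t - α) * w.eval (pt t) := by
    have := congrArg (Polynomial.eval (pt t)) hw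
    simpa using this
  calc _ = b⁻¹ * (val ρ (pt t) * ((pt t - α) * d.eval (pt t)) - (pt t - α) * w.eval (pt t)) := by
        ring
    _ = 1 := by
        rw [h4, ← h6, sub_sub_cancel, inv_mul_cancel₀ hb]

/-- The graph of `T_ω`: the pairs `(g, ℙ f)` with `g ∈ H²`, `f ∈ L²` and `ω g = f + ρ` almost
everywhere on the circle for some `ρ ∈ Rat₀(𝕋)`. -/
def toeplitzGraph (ω : RatFunc ℂ) : Submodule ℂ (H2 × H2) where
  carrier := {x | ∃ f : L2, ∃ ρ ∈ Rat0T,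
    (∀ᵐ t ∂(@AddCircle.haarAddCircle (1 : ℝ) _),
      val ω (pt t) * (x.1 : L2) t = f t + val ρ (pt t)) ∧ x.2 = rieszProj f}
  zero_mem' := by
    refine ⟨0, 0, zero_mem_Rat0T, ?_, by simp⟩
    filter_upwards [Lp.coeFn_zero ℂ 2 (@AddCircle.haarAddCircle (1 : ℝ) _)] with t ht
    have ht' : (((0 : H2 × H2).1 : H2) : L2) t = 0 := ht
    rw [ht', ht]
    simp [val]
  add_mem' := by
    rintro x y ⟨f, ρ, hρ, hf, hx⟩ ⟨g, τ, hτ, hg, hy⟩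
    refine ⟨f + g, ρ + τ, add_mem_Rat0T hρ hτ, ?_, by simp [hx, hy]⟩
    filter_upwards [hf, hg, Lp.coeFn_add f g, Lp.coeFn_add (x.1 : L2) (y.1 : L2),
      ae_not_isPole ρ, ae_not_isPole τ] with t h1 h2 h3 h4 h5 h6
    have h4' : ((x + y).1 : L2) t = (x.1 : L2) t + (y.1 : L2) t := h4
    rw [h4', h3, val_add h5 h6, mul_add, h1, h2, Pi.add_apply]
    ring
  smul_mem' := by
    rintro c x ⟨f, ρ, hρ, hf, hx⟩
    refine ⟨c • f, RatFunc.C c * ρ, C_mul_mem_Rat0T c hρ, ?_, by simp [hx]⟩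
    filter_upwards [hf, Lp.coeFn_smul c f, Lp.coeFn_smul c (x.1 : L2), ae_not_isPole ρ]
      with t h1 h2 h3 h4
    have h3' : ((c • x).1 : L2) t = c * (x.1 : L2) t := h3
    rw [h3', h2, val_C_mul c h4, Pi.smul_apply, smul_eq_mul, mul_left_comm, h1]
    ring

/-- In `ω g = f + ρ` the function `f`, and hence `ℙ f`, is determined by `g`. -/
theorem toeplitzGraph_functional (ω : RatFunc ℂ) (x : H2 × H2) (hx : x ∈ toeplitzGraph ω)
    (h0 : x.1 = 0) : x.2 = 0 := by
  obtain ⟨f, ρ, hρ, hf, hx2⟩ := hx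
  have hae : ∀ᵐ t ∂(@AddCircle.haarAddCircle (1 : ℝ) _), f t + val ρ (pt t) = 0 := by
    filter_upwards [hf, Lp.coeFn_zero ℂ 2 (@AddCircle.haarAddCircle (1 : ℝ) _)] with t h1 h2
    have h3 : (x.1 : L2) t = 0 := by
      rw [h0]
      exact h2
    rw [← h1, h3, mul_zero]
  have hρ0 : ρ = 0 := by
    refine eq_zero_of_ae_eq hρ (-f) ?_
    filter_upwards [hae, Lp.coeFn_neg f] with t h1 h2
    rw [h2, Pi.neg_apply]
    exact eq_neg_of_add_eq_zero_right h1
  have hf0 : f = 0 := by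
    apply Lp.ext
    filter_upwards [hae, Lp.coeFn_zero ℂ 2 (@AddCircle.haarAddCircle (1 : ℝ) _)] with t h1 h2
    rw [h2]
    simpa [hρ0, val] using h1
  rw [hx2, hf0, map_zero]

/-- The Toeplitz-like operator `T_ω (H² → H²)`: its domain consists of the `g ∈ H²` with
`ω g = f + ρ` for some `f ∈ L²` and `ρ ∈ Rat₀(𝕋)`, and `T_ω g = ℙ f`. -/
def toeplitz (ω : RatFunc ℂ) : H2 →ₗ.[ℂ] H2 := (toeplitzGraph ω).toLinearPMap

theorem mem_graph_toeplitz_iff (ω : RatFunc ℂ) (x : H2 × H2) :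
    x ∈ (toeplitz ω).graph ↔ x ∈ toeplitzGraph ω := by
  unfold toeplitz
  rw [Submodule.toLinearPMap_graph_eq _ (toeplitzGraph_functional ω)]

/-! ### Unbounded operators on a Hilbert space -/

section Operators

variable {H : Type*} [NormedAddCommGroup H] [InnerProductSpace ℂ H]

/-- A (possibly unbounded) operator is symmetric if it is densely defined and
`⟪A x, y⟫ = ⟪x, A y⟫` for all `x`, `y` in its domain. -/
def IsSymmetricOp (A : H →ₗ.[ℂ] H) : Prop :=
  Dense (A.domain : Set H) ∧ ∀ x y : A.domain, inner ℂ (A x) (y : H) = inner ℂ (x : H) (A y)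

/-- A (possibly unbounded) operator is Fredholm if it is closed, has finite dimensional kernel,
and has closed range of finite codimension. -/
def IsFredholmOp (A : H →ₗ.[ℂ] H) : Prop :=
  A.IsClosed ∧
  FiniteDimensional ℂ (LinearMap.ker A.toFun) ∧
  IsClosed (LinearMap.range A.toFun : Set H) ∧
  FiniteDimensional ℂ (H ⧸ LinearMap.range A.toFun)

/-- The operator `A - c I`, with the same domain as `A`. -/
def subScalar (A : H →ₗ.[ℂ] H) (c : ℂ) : H →ₗ.[ℂ] H where
  domain := A.domain
  toFun := A.toFun - c • A.domain.subtype

/-- The essential spectrum: the complex numbers `c` such that `A - c I` is not Fredholm. -/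
def essSpectrum (A : H →ₗ.[ℂ] H) : Set ℂ := {c | ¬ IsFredholmOp (subScalar A c)}

end Operators

/-! ### The inverse Cayley transform -/

/-- The inverse Cayley transform `z ↦ -i (z + 1) / (z - 1)`, for `z ≠ 1`. -/
def invCayley (z : ℂ) : ℂ := -Complex.I * ((z + 1) / (z - 1))

/-- The rational function `τ` with real coefficients has poles only on the real line. -/
def PolesOnReal (τ : RatFunc ℝ) : Prop := ∀ w : ℂ, τ.denom.aeval w = 0 → w.im = 0

/-- The identity of rational functions `ω(z) = τ(-i (z + 1) / (z - 1))`, expressed through values: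
it holds wherever both sides are defined, that is, for all but finitely many `z`. -/
def EqCompInvCayley (ω : RatFunc ℂ) (τ : RatFunc ℝ) : Prop :=
  ∀ z : ℂ, z ≠ 1 → ¬ IsPole ω z → τ.denom.aeval (invCayley z) ≠ 0 →
    val ω z = τ.eval (algebraMap ℝ ℂ) (invCayley z)

/-! ### Self-inversive polynomials -/

/-- The polynomial `r♯(z) = z ^ k * conj (r (1 / conj z))` with `k = deg r`, that is, the
polynomial with coefficients `conj r_k, …, conj r_1, conj r_0`. -/
def sharp (r : ℂ[X]) : ℂ[X] := (r.map (starRingEnd ℂ)).reverse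

/-- A polynomial `r ≠ 0` is self-inversive if `r = γ r♯` for some constant `γ`. -/
def SelfInversive (r : ℂ[X]) : Prop := r ≠ 0 ∧ ∃ γ : ℂ, r = C γ * sharp r

end ToeplitzLike

end

open ToeplitzLike

/-!
Let `S` be the shift on `H²` and `m = deg q`. If `ω g = h + ρ` with `ρ ∈ Rat₀(𝕋)`, then
`s g - q h = q ρ` lies in `H²`, which forces it to be a polynomial of degree less than `m`, because
all poles are on the circle. These polynomials form the kernel of `S* ^ m`, so `T_ω g = h` means
exactly `S* ^ m s(S) g = S* ^ m q(S) h`. From here on only two facts about `S` matter: it is an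
isometry without unitary part, and `ker S*` is nonzero and finite dimensional.

As `q♯ = c q` with `|c| = 1`, the operator `S* ^ m q(S)` is a multiple of `q(S)*`, so `T_ω` is the
quotient `(q(S)*)⁻¹ t*` of bounded operators, where `t` is a multiple of `s(S)* S ^ m`. Its adjoint
contains `t q(S)⁻¹` and is symmetric if and only if `t = s(S)`, that is, if and only if
`s q̄ = s̄ q` on the circle. In that case testing against `s(S) q(S)⁻¹ ⊆ T_ω` shows that the adjoint
is contained in `T_ω`. Finally, `T_ω - λ` is Fredholm if and only if `(s - λ q)(S)` is, that is, if
and only if `s - λ q` has no zero on the circle.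
-/

noncomputable section

namespace ToeplitzLike

/-! ### Polynomials on the unit circle -/

theorem induction_on_roots {K : Type*} [Field K] [IsAlgClosed K] {P : K[X] → Prop} {p : K[X]}
    (hp : p ≠ 0) (const : ∀ a, a ≠ 0 → P (C a))
    (X_sub_C_mul : ∀ α r, p.IsRoot α → P r → P ((X - C α) * r)) : P p := by
  suffices h : ∀ m : Multiset K, (∀ α ∈ m, p.IsRoot α) →
      P (C p.leadingCoeff * (m.map (X - C ·)).prod) by
    rw [(IsAlgClosed.splits p).eq_prod_roots]
    exact h p.roots fun _ => isRoot_of_mem_roots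
  intro m
  induction m using Multiset.induction with
  | empty => simpa using const _ (leadingCoeff_ne_zero.mpr hp)
  | cons α m ih =>
    intro h
    rw [Multiset.map_cons, Multiset.prod_cons, mul_left_comm]
    exact X_sub_C_mul α _ (h α (Multiset.mem_cons_self α m))
      (ih fun β hβ => h β (Multiset.mem_cons_of_mem hβ))

theorem infinite_unitCircle : {z : ℂ | ‖z‖ = 1}.Infinite := by
  have h : IsPreconnected {z : ℂ | ‖z‖ = 1} := by
    simpa [Metric.sphere] using
      isPreconnected_sphere (E := ℂ) (by simp [Complex.rank_real_complex]) 0 1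
  exact h.infinite_of_nontrivial ⟨1, by simp, -1, by simp, by norm_num⟩

theorem coeff_zero_sharp (p : ℂ[X]) : (sharp p).coeff 0 = conj p.leadingCoeff := by
  rw [sharp, coeff_zero_reverse, leadingCoeff_map]

theorem sharp_X_pow_mul (k : ℕ) (p : ℂ[X]) : sharp (X ^ k * p) = sharp p := by
  rw [sharp, Polynomial.map_mul, Polynomial.map_pow, map_X, reverse_X_pow_mul, sharp]

theorem sharp_mul (p r : ℂ[X]) : sharp (p * r) = sharp p * sharp r := by
  rw [sharp, Polynomial.map_mul, reverse_mul_of_domain, sharp, sharp]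

theorem sharp_C (a : ℂ) : sharp (C a) = C (conj a) := by
  rw [sharp, map_C, reverse_C]

theorem sharp_X_sub_C {α : ℂ} (hα : ‖α‖ = 1) : sharp (X - C α) = C (-conj α) * (X - C α) := by
  have h : conj α * α = 1 := by rw [RCLike.conj_mul, hα]; simp
  have h1 : sharp (X - C α) = 1 + C (-conj α) * X := by
    rw [sharp, Polynomial.map_sub, map_X, map_C, sub_eq_add_neg, ← C_neg, reverse_add_C,
      show (X : ℂ[X]) = X * C 1 by simp, reverse_X_mul, reverse_C]
    simp
  rw [h1, mul_sub, ← C_mul, neg_mul, h]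
  simp only [map_neg, map_one]
  ring

theorem star_aeval_mul_pow_natDegree {A : Type*} [Ring A] [StarRing A] [Algebra ℂ A]
    [StarModule ℂ A] {a : A} (ha : star a * a = 1) (p : ℂ[X]) :
    star (aeval a p) * a ^ p.natDegree = aeval a (sharp p) := by
  set n := p.natDegree
  have hdeg : (sharp p).natDegree < n + 1 :=
    Nat.lt_succ_of_le ((reverse_natDegree_le _).trans natDegree_map_le)
  have hcancel : ∀ k ≤ n, star (a ^ k) * a ^ n = a ^ (n - k) := fun k hk => by
    rw [star_pow, ← Nat.add_sub_cancel' hk, pow_add, ← mul_assoc, pow_mul_pow_eq_one k ha,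
      one_mul, Nat.add_sub_cancel_left]
  have hcoeff : ∀ k ≤ n, (sharp p).coeff k = conj (p.coeff (n - k)) := fun k hk => by
    rw [sharp, coeff_reverse, natDegree_map, revAt_le hk, coeff_map]
  rw [aeval_eq_sum_range' (Nat.lt_succ_self n), aeval_eq_sum_range' hdeg, star_sum,
    Finset.sum_mul, ← Finset.sum_range_reflect]
  refine Finset.sum_congr rfl fun k hk => ?_
  have hk : k ≤ n := Nat.lt_succ_iff.mp (Finset.mem_range.mp hk)
  rw [show n.succ - 1 - k = n - k from rfl, star_smul, smul_mul_assoc,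
    hcancel _ (Nat.sub_le n k), Nat.sub_sub_self hk, hcoeff k hk, RCLike.star_def]

theorem eval_sharp (p : ℂ[X]) {z : ℂ} (hz : ‖z‖ = 1) :
    (sharp p).eval z = z ^ p.natDegree * conj (p.eval z) := by
  have h : star z * z = 1 := by rw [RCLike.star_def, RCLike.conj_mul, hz]; simp
  simpa [coe_aeval_eq_eval, mul_comm] using (star_aeval_mul_pow_natDegree h p).symm

theorem exists_sharp_eq_C_mul {q : ℂ[X]} (hq : q ≠ 0) (hroots : ∀ z, q.IsRoot z → ‖z‖ = 1) :
    ∃ c : ℂ, ‖c‖ = 1 ∧ sharp q = C c * q := by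
  refine induction_on_roots (P := fun q => ∃ c : ℂ, ‖c‖ = 1 ∧ sharp q = C c * q) hq
    (fun a ha => ⟨conj a / a, ?_, ?_⟩) ?_
  · rw [norm_div, RCLike.norm_conj, div_self (norm_ne_zero_iff.mpr ha)]
  · rw [sharp_C, ← C_mul, div_mul_cancel₀ _ ha]
  · rintro α r hα ⟨c, hc, hr⟩
    refine ⟨-conj α * c, by simp [hroots α hα, hc], ?_⟩
    rw [sharp_mul, sharp_X_sub_C (hroots α hα), hr, C_mul]
    ring

/-- The rational function `s / q` takes real values on the unit circle: off the zeros of `q`, this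
is `s / q = conj (s / q)` with denominators cleared. -/
def RealOnCircle (s q : ℂ[X]) : Prop :=
  ∀ z : ℂ, ‖z‖ = 1 → s.eval z * conj (q.eval z) = conj (s.eval z) * q.eval z

theorem X_pow_mul_sharp_mul_eq_of_infinite {s q : ℂ[X]}
    (h : {z : ℂ | ‖z‖ = 1 ∧ s.eval z * conj (q.eval z) = conj (s.eval z) * q.eval z}.Infinite) :
    X ^ q.natDegree * sharp s * q = X ^ s.natDegree * s * sharp q := by
  refine eq_of_infinite_eval_eq _ _ (h.mono ?_)
  rintro z ⟨hz, h⟩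
  simp only [Set.mem_ofPred_eq, eval_mul, eval_pow, eval_X, eval_sharp _ hz]
  linear_combination -z ^ q.natDegree * z ^ s.natDegree * h

theorem realOnCircle_iff_mul_sharp {s q : ℂ[X]} : RealOnCircle s q ↔
    X ^ q.natDegree * sharp s * q = X ^ s.natDegree * s * sharp q := by
  refine ⟨fun h => X_pow_mul_sharp_mul_eq_of_infinite
    (infinite_unitCircle.mono fun z hz => ⟨hz, h z hz⟩), fun h z hz => ?_⟩
  have hz0 : z ≠ 0 := norm_ne_zero_iff.mp (by simp [hz])
  have heval := congrArg (eval z) h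
  simp only [eval_mul, eval_pow, eval_X, eval_sharp _ hz] at heval
  refine mul_left_cancel₀ (pow_ne_zero (q.natDegree + s.natDegree) hz0) ?_
  linear_combination -heval

theorem realOnCircle_of_finite {s q : ℂ[X]} {F : Set ℂ} (hF : F.Finite)
    (h : ∀ z, ‖z‖ = 1 → z ∉ F → s.eval z * conj (q.eval z) = conj (s.eval z) * q.eval z) :
    RealOnCircle s q :=
  realOnCircle_iff_mul_sharp.mpr <| X_pow_mul_sharp_mul_eq_of_infinite <|
    (infinite_unitCircle.sdiff hF).mono fun z hz => ⟨hz.1, h z hz.1 hz.2⟩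

section SharpEq

variable {s q : ℂ[X]} {c : ℂ} (hq : q ≠ 0) (hc : sharp q = C c * q)
include hq hc

theorem realOnCircle_iff_sharp :
    RealOnCircle s q ↔ X ^ q.natDegree * sharp s = C c * (X ^ s.natDegree * s) := by
  rw [realOnCircle_iff_mul_sharp, hc,
    show X ^ s.natDegree * s * (C c * q) = C c * (X ^ s.natDegree * s) * q by ring]
  exact mul_left_inj' hq

theorem realOnCircle_iff_natDegree_le : RealOnCircle s q ↔
    s = 0 ∨ s.natDegree ≤ q.natDegree ∧
      X ^ (q.natDegree - s.natDegree) * sharp s = C c * s := by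
  rw [realOnCircle_iff_sharp hq hc]
  rcases eq_or_ne s 0 with rfl | hs
  · simp [sharp]
  have hX : (X : ℂ[X]) ^ s.natDegree ≠ 0 := pow_ne_zero _ X_ne_zero
  have hle (h : X ^ q.natDegree * sharp s = C c * (X ^ s.natDegree * s)) :
      s.natDegree ≤ q.natDegree := by
    by_contra! hlt
    have hdvd : X ^ s.natDegree ∣ X ^ q.natDegree * sharp s := ⟨C c * s, by rw [h, mul_left_comm]⟩
    have hzero := X_pow_dvd_iff.mp hdvd q.natDegree hlt
    rw [coeff_X_pow_mul', if_pos le_rfl, Nat.sub_self, coeff_zero_sharp] at hzero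
    simp [hs] at hzero
  have hiff (hle : s.natDegree ≤ q.natDegree) :
      X ^ q.natDegree * sharp s = C c * (X ^ s.natDegree * s) ↔
        X ^ (q.natDegree - s.natDegree) * sharp s = C c * s := by
    rw [← pow_mul_pow_sub X hle, mul_assoc, mul_left_comm (C c)]
    exact mul_right_inj' hX
  rw [or_iff_right hs]
  exact ⟨fun h => ⟨hle h, (hiff (hle h)).mp h⟩, fun h => (hiff h.1).mpr h.2⟩

theorem X_pow_mul_sharp_eq_iff_selfInversive (hs : s ≠ 0) (k : ℕ) :
    X ^ k * sharp s = C c * s ↔ (∃ r : ℂ[X], SelfInversive r ∧ s = X ^ k * r) ∧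
      q.coeff 0 * conj (s.coeff s.natDegree) = conj (q.coeff q.natDegree) * s.coeff k := by
  have hqc : conj (q.coeff q.natDegree) = c * q.coeff 0 := by
    rw [← coeff_C_mul, ← hc, coeff_zero_sharp, leadingCoeff]
  have hcq0 : c * q.coeff 0 ≠ 0 := by simpa [← hqc] using hq
  have hc0 : c ≠ 0 := left_ne_zero_of_mul hcq0
  have hlead : conj (s.coeff s.natDegree) ≠ 0 := by simpa using hs
  have hcoeff (a : ℂ) (h : X ^ k * sharp s = C a * s) :
      conj (s.coeff s.natDegree) = a * s.coeff k := by
    have hk := congrArg (coeff · k) h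
    simpa only [coeff_X_pow_mul', le_refl, if_true, Nat.sub_self, coeff_zero_sharp, coeff_C_mul,
      leadingCoeff] using hk
  constructor
  · intro h
    have hr : s = X ^ k * (C c⁻¹ * sharp s) := by
      rw [mul_left_comm, h, ← mul_assoc, ← C_mul, inv_mul_cancel₀ hc0, C_1, one_mul]
    refine ⟨⟨C c⁻¹ * sharp s, ⟨right_ne_zero_of_mul (hr ▸ hs), c⁻¹, ?_⟩, hr⟩, ?_⟩
    · rw [← sharp_X_pow_mul k (C c⁻¹ * sharp s), ← hr]
    · rw [hqc, hcoeff c h]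
      ring
  · rintro ⟨⟨r, ⟨hr0, γ, hr⟩, hs'⟩, hq0⟩
    have hγ : γ ≠ 0 := by
      rintro rfl
      exact hr0 (by simpa using hr)
    have h : X ^ k * sharp s = C γ⁻¹ * s := by
      rw [hs', sharp_X_pow_mul]
      conv_rhs => rw [hr]
      rw [mul_left_comm, ← mul_assoc (C _), ← C_mul, inv_mul_cancel₀ hγ, C_1, one_mul]
    have hsk : s.coeff k ≠ 0 := right_ne_zero_of_mul (hcoeff _ h ▸ hlead)
    have hcγ : γ⁻¹ = c := by
      refine mul_right_cancel₀ (mul_ne_zero (right_ne_zero_of_mul hcq0) hsk) ?_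
      linear_combination hq0 - q.coeff 0 * hcoeff _ h + s.coeff k * hqc
    rw [h, hcγ]

end SharpEq

theorem realOnCircle_iff_selfInversive {s q : ℂ[X]} (hq : q ≠ 0)
    (hroots : ∀ z, q.IsRoot z → ‖z‖ = 1) :
    RealOnCircle s q ↔ s = 0 ∨ (s.natDegree ≤ q.natDegree ∧
      (∃ r : ℂ[X], SelfInversive r ∧ s = X ^ (q.natDegree - s.natDegree) * r) ∧
      q.coeff 0 * conj (s.coeff s.natDegree) =
        conj (q.coeff q.natDegree) * s.coeff (q.natDegree - s.natDegree)) := by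
  obtain ⟨c, -, hc⟩ := exists_sharp_eq_C_mul hq hroots
  rw [realOnCircle_iff_natDegree_le hq hc]
  refine or_congr_right' fun hs => and_congr_right fun _ => ?_
  exact X_pow_mul_sharp_eq_iff_selfInversive hq hc hs _

theorem RealOnCircle.natDegree_le {s q : ℂ[X]} (h : RealOnCircle s q) (hq : q ≠ 0)
    (hroots : ∀ z, q.IsRoot z → ‖z‖ = 1) : s.natDegree ≤ q.natDegree := by
  rcases (realOnCircle_iff_selfInversive hq hroots).mp h with rfl | ⟨hdeg, -⟩
  · exact Nat.zero_le _
  · exact hdeg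

/-! ### Fredholm operators -/

section Fredholm

variable {E : Type*} [NormedAddCommGroup E] [NormedSpace ℂ E]

theorem isQuasiInverse_of_comp_eq_id {K V W : Type*} [Field K] [AddCommGroup V] [Module K V]
    [AddCommGroup W] [Module K W] {u : V →ₗ[K] W} {v : W →ₗ[K] V} (h : v ∘ₗ u = .id)
    [FiniteDimensional K v.ker] : v.IsQuasiInverse u := by
  refine ⟨by rw [LinearMap.IsLeftQuasiInverse, h], ?_⟩
  rw [LinearMap.IsRightQuasiInverse, LinearMap.FiniteRangeSetoid.equiv_iff_hasNoetherianRange,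
    LinearMap.hasNoetherianRange_iff_range]
  refine isNoetherian_of_le (t := v.ker) ?_
  rintro _ ⟨x, rfl⟩
  have hx : v (u (v x)) = v x := DFunLike.congr_fun h (v x)
  simp [hx]

theorem isFredholm_mul {u v : E →L[ℂ] E} (hu : u.IsFredholm) (hv : v.IsFredholm) :
    (u * v).IsFredholm := by
  obtain ⟨u', hu'⟩ := hu.exists_isQuasiInverse
  obtain ⟨v', hv'⟩ := hv.exists_isQuasiInverse
  exact .of_isQuasiInverse (v := v' * u') (hv'.comp hu')

theorem isFredholm_of_mul {u v : E →L[ℂ] E} (hu : u.IsFredholm) (huv : (u * v).IsFredholm) :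
    v.IsFredholm := by
  obtain ⟨u', hu'⟩ := hu.exists_isQuasiInverse
  obtain ⟨w, hw⟩ := huv.exists_isQuasiInverse
  exact .of_isQuasiInverse (v := w * u) (hu'.of_comp_right hw)

theorem isFredholm_of_isUnit {u : E →L[ℂ] E} (hu : IsUnit u) : u.IsFredholm := by
  obtain ⟨u, rfl⟩ := hu
  have hker : (↑u⁻¹ : E →L[ℂ] E).ker = ⊥ :=
    LinearMap.ker_eq_bot.mpr (Function.LeftInverse.injective (g := (u : E →L[ℂ] E))
      fun x => DFunLike.congr_fun u.mul_inv x)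
  have : FiniteDimensional ℂ (↑u⁻¹ : E →L[ℂ] E).ker := hker ▸ inferInstance
  exact .of_isQuasiInverse (isQuasiInverse_of_comp_eq_id
    (congrArg ContinuousLinearMap.toLinearMap u.inv_mul))

theorem isFredholm_pow {u : E →L[ℂ] E} (hu : u.IsFredholm) (n : ℕ) : (u ^ n).IsFredholm := by
  induction n with
  | zero => exact isFredholm_of_isUnit isUnit_one
  | succ n ih => exact pow_succ u n ▸ isFredholm_mul ih hu

theorem isClosed_range_of_injective_of_coFG [CompleteSpace E] {u : E →L[ℂ] E}
    (hu : Function.Injective u) (h : u.range.CoFG) : IsClosed (u.range : Set E) := by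
  obtain ⟨G, hG⟩ := Submodule.exists_isCompl u.range
  have : FiniteDimensional ℂ G := Module.Finite.iff_fg.mpr (h.fg_of_isCompl hG)
  exact u.closed_complemented_range_of_isCompl_of_ker_eq_bot G hG G.closed_of_finiteDimensional
    (LinearMap.ker_eq_bot.mpr hu)

end Fredholm

section HilbertSpace

variable {H : Type*} [NormedAddCommGroup H] [InnerProductSpace ℂ H] [CompleteSpace H]

theorem denseRange_of_injective_star {T : H →L[ℂ] H}
    (hT : Function.Injective (star T : H →L[ℂ] H)) : DenseRange T := by
  have h : T.rangeᗮ = ⊥ := by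
    rw [ContinuousLinearMap.orthogonal_range]
    exact LinearMap.ker_eq_bot.mpr hT
  exact (Submodule.dense_iff_topologicalClosure_eq_top (s := T.range)).mpr
    (Submodule.topologicalClosure_eq_top_iff.mpr h)

/-- A pure isometry of a Hilbert space: an isometry without unitary part, which by the Wold
decomposition means that the ranges of its powers have trivial intersection. -/
structure IsPureIsometry (S : H →L[ℂ] H) : Prop where
  star_mul_self : star S * S = 1
  iInf_range_pow : ⨅ n : ℕ, (S ^ n).range = ⊥

namespace IsPureIsometry

variable {S : H →L[ℂ] H} (hS : IsPureIsometry S)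
include hS

theorem norm_apply (x : H) : ‖S x‖ = ‖x‖ :=
  (ContinuousLinearMap.norm_map_iff_adjoint_comp_self S).mpr hS.star_mul_self x

theorem eq_zero_of_apply_eq_smul {α : ℂ} {x : H} (h : S x = α • x) : x = 0 := by
  rcases eq_or_ne α 0 with rfl | hα
  · rw [← norm_eq_zero, ← hS.norm_apply, h, zero_smul, norm_zero]
  have hmem (n : ℕ) : x ∈ (S ^ n).range := by
    have hn : (S ^ n) x = α ^ n • x := by
      induction n with
      | zero => simp
      | succ n ih => rw [pow_succ, mul_apply_eq_comp, h, map_smul, ih, smul_smul, pow_succ']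
    exact ⟨(α ^ n)⁻¹ • x, by
      rw [map_smul, ContinuousLinearMap.coe_coe, hn, inv_smul_smul₀ (pow_ne_zero n hα)]⟩
  have hx : x ∈ ⨅ n : ℕ, (S ^ n).range := (Submodule.mem_iInf _).mpr hmem
  rwa [hS.iInf_range_pow, Submodule.mem_bot] at hx

theorem apply_eq_smul_of_star_apply_eq_smul {α : ℂ} (hα : ‖α‖ = 1) {x : H}
    (h : star S x = conj α • x) : S x = α • x := by
  have hinner : inner ℂ (S x) (α • x) = (‖x‖ : ℂ) ^ 2 := by
    rw [inner_smul_right, ← ContinuousLinearMap.adjoint_inner_right,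
      ← ContinuousLinearMap.star_eq_adjoint, h, inner_smul_right, ← mul_assoc, RCLike.mul_conj, hα]
    simp [inner_self_eq_norm_sq_to_K]
  rw [← sub_eq_zero, ← norm_eq_zero, ← sq_eq_zero_iff, norm_sub_sq (𝕜 := ℂ), hinner, norm_smul, hα,
    hS.norm_apply, ← Complex.ofReal_pow, RCLike.re_eq_complex_re, Complex.ofReal_re]
  ring

theorem injective_sub_algebraMap (α : ℂ) :
    Function.Injective (S - algebraMap ℂ (H →L[ℂ] H) α) := by
  rw [injective_iff_map_eq_zero]
  intro x hx
  refine hS.eq_zero_of_apply_eq_smul (sub_eq_zero.mp ?_) (α := α)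
  simpa [Algebra.algebraMap_eq_smul_one] using hx

theorem injective_star_sub_algebraMap {α : ℂ} (hα : ‖α‖ = 1) :
    Function.Injective (star (S - algebraMap ℂ (H →L[ℂ] H) α) : H →L[ℂ] H) := by
  rw [injective_iff_map_eq_zero]
  intro x hx
  refine hS.eq_zero_of_apply_eq_smul (hS.apply_eq_smul_of_star_apply_eq_smul hα (sub_eq_zero.mp ?_))
  simpa [Algebra.algebraMap_eq_smul_one] using hx

theorem injective_aeval {p : ℂ[X]} (hp : p ≠ 0) : Function.Injective (aeval S p) := by
  refine induction_on_roots (P := fun p => Function.Injective (aeval S p)) hp (fun a ha => ?_)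
    fun α r _ hr => ?_
  · rw [aeval_C, Algebra.algebraMap_eq_smul_one]
    exact smul_right_injective H ha
  · rw [map_mul, map_sub, aeval_X, aeval_C]
    exact (hS.injective_sub_algebraMap α).comp hr

theorem injective_star_aeval {p : ℂ[X]} (hp : p ≠ 0) (hroots : ∀ z, p.IsRoot z → ‖z‖ = 1) :
    Function.Injective (star (aeval S p) : H →L[ℂ] H) := by
  refine induction_on_roots (P := fun p => Function.Injective (star (aeval S p) : H →L[ℂ] H)) hp
    (fun a ha => ?_) fun α r hα hr => ?_
  · rw [aeval_C, Algebra.algebraMap_eq_smul_one, star_smul, star_one]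
    exact smul_right_injective H (star_ne_zero.mpr ha)
  · rw [map_mul, map_sub, aeval_X, aeval_C, star_mul]
    exact hr.comp (hS.injective_star_sub_algebraMap (hroots α hα))

theorem aeval_injective [Nontrivial H] : Function.Injective (aeval (R := ℂ) S) := by
  refine (injective_iff_map_eq_zero _).mpr fun p hp => ?_
  by_contra h
  obtain ⟨x, hx⟩ := exists_ne (0 : H)
  exact hx (hS.injective_aeval h (by simp [hp]))

theorem norm_le_one : ‖S‖ ≤ 1 :=
  S.opNorm_le_bound zero_le_one fun x => by rw [hS.norm_apply, one_mul]

theorem isFredholm_star [FiniteDimensional ℂ (star S).ker] : (star S).IsFredholm :=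
  .of_isQuasiInverse (isQuasiInverse_of_comp_eq_id
    (congrArg ContinuousLinearMap.toLinearMap hS.star_mul_self)).symm

theorem isFredholm_sub_algebraMap [FiniteDimensional ℂ (star S).ker] {α : ℂ} (hα : ‖α‖ ≠ 1) :
    (S - algebraMap ℂ (H →L[ℂ] H) α).IsFredholm := by
  rcases hα.lt_or_gt with hlt | hgt
  · refine isFredholm_of_mul hS.isFredholm_star (isFredholm_of_isUnit ?_)
    have hunit : IsUnit (1 - α • star S) := by
      refine isUnit_one_sub_of_norm_lt_one ?_
      rw [norm_smul, norm_star]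
      exact (mul_le_of_le_one_right (norm_nonneg _) hS.norm_le_one).trans_lt hlt
    rwa [mul_sub, hS.star_mul_self, ← Algebra.commutes, ← Algebra.smul_def]
  · refine isFredholm_of_isUnit ?_
    have hmem : α ∉ spectrum ℂ S := fun h => hgt.not_ge <|
      (spectrum.norm_le_norm_mul_of_mem h).trans
        (mul_le_one₀ hS.norm_le_one (norm_nonneg _) ContinuousLinearMap.norm_id_le)
    rw [← IsUnit.neg_iff, neg_sub]
    exact spectrum.notMem_iff.mp hmem

theorem isFredholm_aeval [FiniteDimensional ℂ (star S).ker] {p : ℂ[X]}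
    (hp : ∀ z, ‖z‖ = 1 → ¬ p.IsRoot z) : (aeval S p).IsFredholm := by
  have hp0 : p ≠ 0 := by
    rintro rfl
    exact hp 1 (by simp) (by simp)
  refine induction_on_roots (P := fun p => (aeval S p).IsFredholm) hp0
    (fun a ha => isFredholm_of_isUnit ?_) fun α r hα hr => ?_
  · rw [aeval_C]
    exact (IsUnit.mk0 a ha).map (algebraMap ℂ (H →L[ℂ] H))
  · rw [map_mul, map_sub, aeval_X, aeval_C]
    exact isFredholm_mul (hS.isFredholm_sub_algebraMap fun h => hp α h hα) hr

theorem not_coFG_range_sub_algebraMap (hker : (star S).ker ≠ ⊥) {α : ℂ} (hα : ‖α‖ = 1) :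
    ¬ (S - algebraMap ℂ (H →L[ℂ] H) α).range.CoFG := by
  intro h
  have hclosed := isClosed_range_of_injective_of_coFG (hS.injective_sub_algebraMap α) h
  have hdense := denseRange_of_injective_star (hS.injective_star_sub_algebraMap hα)
  obtain ⟨v, hv, hv0⟩ := Submodule.exists_mem_ne_zero_of_ne_bot hker
  obtain ⟨x, hx⟩ : v ∈ Set.range (S - algebraMap ℂ (H →L[ℂ] H) α) :=
    hclosed.closure_subset (hdense v)
  have hx : S x - α • x = v := by simpa [Algebra.algebraMap_eq_smul_one] using hx
  have hstar : star S v = x - α • star S x := by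
    rw [← hx, map_sub, map_smul, ← mul_apply_eq_comp, hS.star_mul_self, one_apply_eq_self]
  have hxα : star S x = conj α • x := by
    have hαx : x = α • star S x := sub_eq_zero.mp (hstar.symm.trans hv)
    conv_rhs => rw [hαx, smul_smul, RCLike.conj_mul, hα]
    simp
  rw [hS.apply_eq_smul_of_star_apply_eq_smul hα hxα, sub_self] at hx
  exact hv0 hx.symm

theorem not_coFG_range_aeval (hker : (star S).ker ≠ ⊥) {p : ℂ[X]} {α : ℂ} (hα : ‖α‖ = 1)
    (hp : p.IsRoot α) : ¬ (aeval S p).range.CoFG := by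
  obtain ⟨r, rfl⟩ := dvd_iff_isRoot.mpr hp
  refine fun h => hS.not_coFG_range_sub_algebraMap hker hα (h.of_le ?_)
  rw [map_mul, map_sub, aeval_X, aeval_C]
  exact LinearMap.range_comp_le_range _ _

end IsPureIsometry

end HilbertSpace

/-! ### Quotients of bounded operators -/

section CoFG

variable {K V W U : Type*} [Field K] [AddCommGroup V] [Module K V] [AddCommGroup W] [Module K W]
  [AddCommGroup U] [Module K U]

theorem cofg_comap (f : V →ₗ[K] W) {P : Submodule K W} (hP : P.CoFG) : (P.comap f).CoFG := by
  have := hP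
  simpa [LinearMap.ker_comp] using Submodule.CoFG.ker (P.mkQ ∘ₗ f)

theorem cofg_of_cofg_comap {f : V →ₗ[K] W} {P : Submodule K W} (hsup : P ⊔ f.range = ⊤)
    (h : (P.comap f).CoFG) : P.CoFG := by
  obtain ⟨L, hL⟩ := Submodule.exists_isCompl (P.comap f)
  refine ((h.fg_of_isCompl hL).map f).cofg_of_codisjoint (codisjoint_iff.mpr ?_)
  have hrange : f.range ≤ P ⊔ L.map f := by
    rw [← Submodule.map_top, ← hL.sup_eq_top, Submodule.map_sup]
    exact sup_le_sup_right (Submodule.map_comap_le f P) _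
  rw [sup_comm, eq_top_iff, ← hsup]
  exact sup_le le_sup_left hrange

theorem cofg_range_of_cofg_range_comp {g : W →ₗ[K] U} {f : V →ₗ[K] W} [FiniteDimensional K g.ker]
    (h : (g ∘ₗ f).range.CoFG) : f.range.CoFG := by
  have hsup : (f.range ⊔ g.ker).CoFG := by
    rw [← Submodule.comap_map_eq, ← LinearMap.range_comp]
    exact cofg_comap g h
  obtain ⟨L, hL⟩ := Submodule.exists_isCompl (f.range ⊔ g.ker)
  have hfg : (g.ker ⊔ L).FG := (Module.Finite.iff_fg.mp inferInstance).sup (hsup.fg_of_isCompl hL)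
  refine hfg.cofg_of_codisjoint (codisjoint_iff.mpr ?_)
  rw [sup_comm, ← sup_assoc, hL.sup_eq_top]

end CoFG

section QuotientGraph

variable {H : Type*} [NormedAddCommGroup H] [InnerProductSpace ℂ H] {A : H →ₗ.[ℂ] H}

/-- The closed linear relation `Q⁻¹ T` in `H × H`. The Toeplitz-like operators and their
translates by scalars are the operators whose graph has this form, for suitable `T` and `Q`. -/
def quotientGraph (T Q : H →L[ℂ] H) : Submodule ℂ (H × H) :=
  LinearMap.eqLocus ((T : H →ₗ[ℂ] H) ∘ₗ .fst ℂ H H) ((Q : H →ₗ[ℂ] H) ∘ₗ .snd ℂ H H)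

theorem mem_quotientGraph {T Q : H →L[ℂ] H} {x : H × H} :
    x ∈ quotientGraph T Q ↔ T x.1 = Q x.2 :=
  Iff.rfl

theorem quotientGraph_smul {c : ℂ} (hc : c ≠ 0) (T Q : H →L[ℂ] H) :
    quotientGraph (c • T) (c • Q) = quotientGraph T Q :=
  Submodule.ext fun x => (smul_right_injective H hc).eq_iff (a := T x.1)

theorem graph_subScalar {T Q : H →L[ℂ] H} (hA : A.graph = quotientGraph T Q) (c : ℂ) :
    (subScalar A c).graph = quotientGraph (T - c • Q) Q := by
  ext ⟨x, y⟩
  have hgraph : (x, y) ∈ (subScalar A c).graph ↔ (x, y + c • x) ∈ A.graph := by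
    rw [LinearPMap.mem_graph_iff, LinearPMap.mem_graph_iff]
    refine exists_congr fun z => and_congr_right fun (hz : (z : H) = x) => ?_
    change A z - c • (z : H) = y ↔ A z = y + c • x
    rw [sub_eq_iff_eq_add, hz]
  rw [hgraph, hA, mem_quotientGraph, mem_quotientGraph, map_add, map_smul, ← sub_eq_iff_eq_add]
  rfl

section Fredholm

variable {T Q : H →L[ℂ] H} (hA : A.graph = quotientGraph T Q)
include hA

theorem range_toFun_eq_comap : LinearMap.range A.toFun = T.range.comap (Q : H →ₗ[ℂ] H) := by
  ext y
  have hy : y ∈ LinearMap.range A.toFun ↔ ∃ x, (x, y) ∈ A.graph := LinearPMap.mem_range_iff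
  rw [hy, hA]
  rfl

theorem map_ker_toFun_le : (LinearMap.ker A.toFun).map A.domain.subtype ≤ T.ker := by
  rintro _ ⟨x, hx, rfl⟩
  have hgraph : T x = Q (A x) := mem_quotientGraph.mp (hA ▸ A.mem_graph x)
  rwa [show A x = 0 from hx, map_zero] at hgraph

theorem isFredholmOp_of_isFredholm (hT : T.IsFredholm) : IsFredholmOp A := by
  refine ⟨?_, ?_, ?_, ?_⟩
  · rw [LinearPMap.IsClosed, hA]
    exact isClosed_eq (T.continuous.comp continuous_fst) (Q.continuous.comp continuous_snd)
  · have := hT.finite_ker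
    have := Submodule.finiteDimensional_of_le (map_ker_toFun_le hA)
    exact .equiv (A.toFun.ker.equivMapOfInjective _ A.domain.subtype_injective).symm
  · rw [range_toFun_eq_comap hA]
    exact hT.isClosed_range.preimage Q.continuous
  · rw [range_toFun_eq_comap hA]
    exact cofg_comap _ hT.finite_coker

theorem cofg_range_of_isFredholmOp (hTQ : T.range ⊔ Q.range = ⊤) (h : IsFredholmOp A) :
    T.range.CoFG :=
  cofg_of_cofg_comap hTQ (range_toFun_eq_comap hA ▸ h.2.2.2)

end Fredholm

section Adjoint

variable [CompleteSpace H] {t s q : H →L[ℂ] H} (hA : A.graph = quotientGraph (star t) (star q))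
  (htq : star t * q = star q * s) (hq : Function.Injective (star q : H →L[ℂ] H))

include hA htq

theorem apply_mem_graph (u : H) : (q u, s u) ∈ A.graph :=
  hA ▸ DFunLike.congr_fun htq u

include hq

theorem dense_domain_of_graph_eq : Dense (A.domain : Set H) := by
  refine (denseRange_of_injective_star hq).mono ?_
  rintro _ ⟨u, rfl⟩
  exact LinearPMap.mem_domain_iff.mpr ⟨_, apply_mem_graph hA htq u⟩

theorem apply_mem_adjoint_graph (u : H) : (q u, t u) ∈ A.adjoint.graph := by
  have h (x : A.domain) : inner ℂ (t u) (x : H) = inner ℂ (q u) (A x) := by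
    rw [← ContinuousLinearMap.adjoint_inner_right, ← ContinuousLinearMap.adjoint_inner_right]
    exact congrArg _ (mem_quotientGraph.mp (hA ▸ A.mem_graph x))
  exact A.adjoint.mem_graph_iff.mpr ⟨⟨q u, LinearPMap.mem_adjoint_domain_of_exists _ ⟨_, h⟩⟩, rfl,
    LinearPMap.adjoint_apply_eq (dense_domain_of_graph_eq hA htq hq) _ h⟩

theorem eq_of_isSymmetricOp_adjoint (h : IsSymmetricOp A.adjoint) : t = s := by
  ext v
  refine hq (ext_inner_left ℂ fun u => ?_)
  obtain ⟨x, hx, hxt⟩ := A.adjoint.mem_graph_iff.mp (apply_mem_adjoint_graph hA htq hq u)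
  obtain ⟨y, hy, hyt⟩ := A.adjoint.mem_graph_iff.mp (apply_mem_adjoint_graph hA htq hq v)
  have hxy : inner ℂ (t u) (q v) = inner ℂ (q u) (t v) := by simpa [hx, hxt, hy, hyt] using h.2 x y
  rw [← ContinuousLinearMap.adjoint_inner_right, ← ContinuousLinearMap.adjoint_inner_right] at hxy
  exact hxy.symm.trans (congrArg _ (DFunLike.congr_fun htq v))

theorem adjoint_le (h : t = s) : A.adjoint ≤ A := by
  refine LinearPMap.le_of_le_graph fun ⟨g, w⟩ hgw => ?_
  obtain ⟨x, hx, hxw⟩ := A.adjoint.mem_graph_iff.mp hgw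
  rw [hA, mem_quotientGraph]
  refine ext_inner_right ℂ fun u => ?_
  obtain ⟨y, hy, hys⟩ := A.mem_graph_iff.mp (apply_mem_graph hA htq u)
  have hxy : inner ℂ w (q u) = inner ℂ g (s u) := by
    simpa [hx, hxw, hy, hys] using
      LinearPMap.adjoint_isFormalAdjoint (dense_domain_of_graph_eq hA htq hq) x y
  rw [← ContinuousLinearMap.adjoint_inner_left, ← ContinuousLinearMap.adjoint_inner_left, ← h]
    at hxy
  exact hxy.symm

theorem isSymmetricOp_adjoint_iff : IsSymmetricOp A.adjoint ↔ t = s := by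
  refine ⟨eq_of_isSymmetricOp_adjoint hA htq hq, fun h => ⟨?_, fun x y => ?_⟩⟩
  · refine (denseRange_of_injective_star hq).mono ?_
    rintro _ ⟨u, rfl⟩
    exact LinearPMap.mem_domain_iff.mpr ⟨_, apply_mem_adjoint_graph hA htq hq u⟩
  · have hle := adjoint_le hA htq hq h
    rw [LinearPMap.adjoint_isFormalAdjoint (dense_domain_of_graph_eq hA htq hq) x ⟨y, hle.1 y.2⟩,
      hle.2 (x := y) (y := ⟨y, hle.1 y.2⟩) rfl]

end Adjoint

end QuotientGraph

namespace IsPureIsometry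

variable {H : Type*} [NormedAddCommGroup H] [InnerProductSpace ℂ H] [CompleteSpace H]
  {S : H →L[ℂ] H} (hS : IsPureIsometry S) {A : H →ₗ.[ℂ] H} {s q : ℂ[X]}
include hS

theorem range_sup_range_of_isCoprime (hsq : IsCoprime s q) (n : ℕ) :
    (star S ^ n * aeval S s).range ⊔ (star S ^ n * aeval S q).range = ⊤ := by
  obtain ⟨a, b, hab⟩ := hsq
  have h : star S ^ n * aeval S s * (aeval S a * S ^ n) +
      star S ^ n * aeval S q * (aeval S b * S ^ n) = 1 := by
    rw [mul_assoc, mul_assoc, ← mul_add, ← mul_assoc, ← mul_assoc, ← add_mul, ← map_mul,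
      ← map_mul, ← map_add, mul_comm s, mul_comm q, hab, map_one, one_mul,
      pow_mul_pow_eq_one n hS.star_mul_self]
  refine eq_top_iff.mpr fun x _ => ?_
  rw [show x = _ from (DFunLike.congr_fun h x).symm]
  exact Submodule.add_mem_sup ⟨_, rfl⟩ ⟨_, rfl⟩

theorem isFredholmOp_iff [FiniteDimensional ℂ (star S).ker] (hker : (star S).ker ≠ ⊥)
    (hsq : IsCoprime s q) {n : ℕ}
    (hA : A.graph = quotientGraph (star S ^ n * aeval S s) (star S ^ n * aeval S q)) :
    IsFredholmOp A ↔ ∀ z, ‖z‖ = 1 → ¬ s.IsRoot z := by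
  have hpow := isFredholm_pow hS.isFredholm_star n
  refine ⟨fun h z hz hs => ?_, fun h => isFredholmOp_of_isFredholm hA
    (isFredholm_mul hpow (hS.isFredholm_aeval h))⟩
  have := hpow.finite_ker
  have hrange := cofg_range_of_isFredholmOp hA (hS.range_sup_range_of_isCoprime hsq n) h
  rw [ContinuousLinearMap.toLinearMap_mul] at hrange
  exact hS.not_coFG_range_aeval hker hz hs (cofg_range_of_cofg_range_comp hrange)

theorem mem_essSpectrum_iff [FiniteDimensional ℂ (star S).ker] (hker : (star S).ker ≠ ⊥)
    (hsq : IsCoprime s q) {n : ℕ}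
    (hA : A.graph = quotientGraph (star S ^ n * aeval S s) (star S ^ n * aeval S q)) {c : ℂ} :
    c ∈ essSpectrum A ↔ ∃ z, ‖z‖ = 1 ∧ s.eval z = c * q.eval z := by
  have hgraph : (subScalar A c).graph =
      quotientGraph (star S ^ n * aeval S (s - C c * q)) (star S ^ n * aeval S q) := by
    rw [graph_subScalar hA, map_sub, map_mul, aeval_C, mul_sub, ← Algebra.smul_def, mul_smul_comm]
  have hcoprime : IsCoprime (s - C c * q) q := by
    simpa [sub_eq_add_neg] using hsq.add_mul_right_left (-C c)
  rw [essSpectrum, Set.mem_ofPred_eq, hS.isFredholmOp_iff hker hcoprime hgraph]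
  simp [sub_eq_zero]

section Adjoint

variable {c : ℂ} (hq : q ≠ 0) (hc1 : ‖c‖ = 1) (hc : sharp q = C c * q)

include hc1 hc in
theorem star_aeval_eq_smul_of_sharp_eq :
    star (aeval S q) = c • (star S ^ q.natDegree * aeval S q) := by
  have h : star S ^ q.natDegree * aeval S q = conj c • star (aeval S q) := by
    rw [← star_pow, ← star_star (aeval S q), ← star_mul,
      star_aeval_mul_pow_natDegree hS.star_mul_self, hc, map_mul, aeval_C, ← Algebra.smul_def,
      star_smul, RCLike.star_def, star_star]
  rw [h, smul_smul, RCLike.mul_conj, hc1]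
  simp

include hq hc in
theorem star_aeval_mul_pow_eq_iff_realOnCircle [Nontrivial H] :
    star (aeval S s) * S ^ q.natDegree = c • aeval S s ↔ RealOnCircle s q := by
  refine ⟨fun h => (realOnCircle_iff_sharp hq hc).mpr (hS.aeval_injective ?_), fun h => ?_⟩
  · calc aeval S (X ^ q.natDegree * sharp s)
        = aeval S (sharp s) * S ^ q.natDegree := by rw [mul_comm, map_mul, map_pow, aeval_X]
      _ = star (aeval S s) * S ^ q.natDegree * S ^ s.natDegree := by
        rw [← star_aeval_mul_pow_natDegree hS.star_mul_self, mul_assoc, mul_assoc,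
          ← pow_add, ← pow_add, add_comm]
      _ = aeval S (C c * (X ^ s.natDegree * s)) := by
        rw [h, mul_comm (X ^ _), ← mul_assoc, map_mul, map_mul, aeval_C, map_pow, aeval_X,
          ← Algebra.smul_def]
  · obtain rfl | ⟨hdeg, hsharp⟩ := (realOnCircle_iff_natDegree_le hq hc).mp h
    · simp
    · rw [← pow_mul_pow_sub S hdeg, ← mul_assoc, star_aeval_mul_pow_natDegree hS.star_mul_self,
        Algebra.smul_def, ← aeval_C, ← map_mul, ← hsharp, mul_comm (X ^ _), map_mul, map_pow,
        aeval_X]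

variable (hroots : ∀ z, q.IsRoot z → ‖z‖ = 1)
  (hA : A.graph =
    quotientGraph (star S ^ q.natDegree * aeval S s) (star S ^ q.natDegree * aeval S q))
include hq hroots hA

theorem exists_graph_eq_quotientGraph_star [Nontrivial H] : ∃ t : H →L[ℂ] H,
    A.graph = quotientGraph (star t) (star (aeval S q)) ∧
      star t * aeval S q = star (aeval S q) * aeval S s ∧
      (t = aeval S s ↔ RealOnCircle s q) := by
  obtain ⟨c, hc1, hc⟩ := exists_sharp_eq_C_mul hq hroots
  have hc0 : c ≠ 0 := norm_ne_zero_iff.mp (hc1 ▸ one_ne_zero)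
  have hq' := hS.star_aeval_eq_smul_of_sharp_eq hc1 hc
  have hstar : star (conj c • (star (aeval S s) * S ^ q.natDegree)) =
      c • (star S ^ q.natDegree * aeval S s) := by
    rw [star_smul, RCLike.star_def, Complex.conj_conj, star_mul, star_star, star_pow]
  refine ⟨conj c • (star (aeval S s) * S ^ q.natDegree), ?_, ?_, ?_⟩
  · rw [hA, hstar, hq', quotientGraph_smul hc0]
  · rw [hstar, hq', smul_mul_assoc, smul_mul_assoc, mul_assoc, mul_assoc, ← map_mul, ← map_mul,
      mul_comm s]
  · rw [← hS.star_aeval_mul_pow_eq_iff_realOnCircle hq hc, ← Complex.inv_eq_conj hc1]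
    exact inv_smul_eq_iff₀ hc0

theorem isSymmetricOp_adjoint_iff_realOnCircle [Nontrivial H] :
    IsSymmetricOp A.adjoint ↔ RealOnCircle s q := by
  obtain ⟨t, hgraph, hcomm, ht⟩ := hS.exists_graph_eq_quotientGraph_star hq hroots hA
  rw [← ht]
  exact isSymmetricOp_adjoint_iff hgraph hcomm (hS.injective_star_aeval hq hroots)

theorem adjoint_le_of_realOnCircle [Nontrivial H] (h : RealOnCircle s q) : A.adjoint ≤ A := by
  obtain ⟨t, hgraph, hcomm, ht⟩ := hS.exists_graph_eq_quotientGraph_star hq hroots hA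
  exact adjoint_le hgraph hcomm (hS.injective_star_aeval hq hroots) (ht.mpr h)

end Adjoint

end IsPureIsometry

section Cyclic

variable {H : Type*} [NormedAddCommGroup H] [InnerProductSpace ℂ H] [CompleteSpace H]
  {S : H →L[ℂ] H} {e : H} (he : star S e = 0)
  (hcyclic : ∀ x : H, (∀ n : ℕ, inner ℂ ((S ^ n) e) x = 0) → x = 0)
include he hcyclic

theorem isPureIsometry_of_cyclic (hS : star S * S = 1) : IsPureIsometry S where
  star_mul_self := hS
  iInf_range_pow := by
    refine (Submodule.eq_bot_iff _).mpr fun x hx => hcyclic x fun n => ?_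
    obtain ⟨y, rfl⟩ := (Submodule.mem_iInf _).mp hx (n + 1)
    rw [ContinuousLinearMap.coe_coe, ← ContinuousLinearMap.adjoint_inner_right,
      ← ContinuousLinearMap.star_eq_adjoint, star_pow, pow_succ, mul_apply_eq_comp,
      ← mul_apply_eq_comp, pow_mul_pow_eq_one n hS, one_apply_eq_self,
      ← ContinuousLinearMap.adjoint_inner_left, ← ContinuousLinearMap.star_eq_adjoint, he,
      inner_zero_left]

theorem ker_star_eq_span_of_cyclic (hnorm : ‖e‖ = 1) : (star S).ker = ℂ ∙ e := by
  refine le_antisymm (fun x hx => ?_) ((Submodule.span_singleton_le_iff_mem _ _).mpr he)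
  refine Submodule.mem_span_singleton.mpr ⟨inner ℂ e x, ?_⟩
  refine (sub_eq_zero.mp (hcyclic _ fun n => ?_)).symm
  cases n with
  | zero => simp [inner_self_eq_norm_sq_to_K, hnorm]
  | succ n =>
    have hx : star S x = 0 := hx
    rw [pow_succ', mul_apply_eq_comp, ← ContinuousLinearMap.adjoint_inner_right,
      ← ContinuousLinearMap.star_eq_adjoint, map_sub, map_smul, he, hx]
    simp

end Cyclic

namespace IsPureIsometry

variable {H : Type*} [NormedAddCommGroup H] [InnerProductSpace ℂ H] [CompleteSpace H]
  {S : H →L[ℂ] H} (hS : IsPureIsometry S)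
include hS

theorem star_pow_apply_eq_zero_iff {e : H} (he : (star S).ker = ℂ ∙ e) {m : ℕ} {x : H} :
    (star S ^ m) x = 0 ↔ ∃ p : ℂ[X], p.degree < m ∧ aeval S p e = x := by
  have hstar (y : H) : star S (S y) = y := DFunLike.congr_fun hS.star_mul_self y
  have hstar_e : star S e = 0 := by
    rw [← ContinuousLinearMap.coe_coe, ← LinearMap.mem_ker, he]
    exact Submodule.mem_span_singleton_self e
  have hX (p : ℂ[X]) (c : ℂ) : aeval S (X * p + C c) e = S (aeval S p e) + c • e := by
    simp [Algebra.algebraMap_eq_smul_one]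
  induction m generalizing x with
  | zero => simp [eq_comm (a := (0 : H))]
  | succ m ih =>
    rw [pow_succ, mul_apply_eq_comp]
    refine ih.trans ?_
    constructor
    · rintro ⟨p, hp, hpx⟩
      obtain ⟨c, hc⟩ : ∃ c : ℂ, c • e = x - S (star S x) := by
        rw [← Submodule.mem_span_singleton, ← he, LinearMap.mem_ker]
        exact (map_sub _ _ _).trans (sub_eq_zero.mpr (hstar _).symm)
      refine ⟨X * p + C c, ?_, by rw [hX, hpx, hc, add_sub_cancel]⟩
      rw [degree_lt_iff_coeff_zero] at hp ⊢
      rintro (_ | k) hk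
      · omega
      · rw [coeff_add, coeff_X_mul, coeff_C_succ, add_zero, hp k (by omega)]
    · rintro ⟨p, hp, rfl⟩
      refine ⟨p.divX, ?_, ?_⟩
      · rw [degree_lt_iff_coeff_zero] at hp ⊢
        exact fun k hk => by rw [coeff_divX, hp _ (by omega)]
      · conv_rhs => rw [← p.X_mul_divX_add, hX, map_add, hstar, map_smul, hstar_e]
        simp

theorem star_pow_apply_eq_zero_of_aeval {r : ℂ[X]} (hr : r ≠ 0)
    (hroots : ∀ z, r.IsRoot z → ‖z‖ = 1) {m : ℕ} {x : H}
    (h : (star S ^ (m + r.natDegree)) (aeval S r x) = 0) : (star S ^ m) x = 0 := by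
  obtain ⟨c, hc1, hc⟩ := exists_sharp_eq_C_mul hr hroots
  refine hS.injective_star_aeval hr hroots ?_
  have hcomm : star (aeval S r) * star S ^ m = star S ^ m * star (aeval S r) := by
    rw [← star_pow, ← star_mul, ← star_mul, ← aeval_X_pow (R := ℂ) S, ← map_mul, ← map_mul,
      mul_comm]
  rw [map_zero, ← mul_apply_eq_comp, hcomm, hS.star_aeval_eq_smul_of_sharp_eq hc1 hc,
    mul_smul_comm, ← mul_assoc, ← pow_add]
  exact (congrArg (c • ·) h).trans (smul_zero c)

end IsPureIsometry

/-! ### The shift on the Hardy space -/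

local notation "𝔪" => @AddCircle.haarAddCircle (1 : ℝ) _

/-- Multiplication by the coordinate function `z` on `L²` of the circle. -/
def mulPt : L2 →L[ℂ] L2 :=
  (ContinuousLinearMap.mul ℂ ℂ).holderL 𝔪 ⊤ 2 2 (fourierLp ⊤ 1)

theorem coeFn_mulPt (f : L2) : ∀ᵐ t ∂𝔪, mulPt f t = pt t * f t := by
  filter_upwards [(ContinuousLinearMap.mul ℂ ℂ).coeFn_holder (r := 2) (fourierLp ⊤ 1) f,
    coeFn_fourierLp ⊤ 1] with t h1 h2
  refine h1.trans ?_
  rw [h2, fourier_one]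
  rfl

theorem coeFn_aeval_mulPt (p : ℂ[X]) (f : L2) :
    ∀ᵐ t ∂𝔪, aeval mulPt p f t = p.eval (pt t) * f t := by
  induction p using Polynomial.induction_on' with
  | add p r hp hr =>
    filter_upwards [hp, hr, Lp.coeFn_add (aeval mulPt p f) (aeval mulPt r f)] with t h1 h2 h3
    rw [map_add, eval_add, add_mul, ← h1, ← h2]
    exact h3
  | monomial k a =>
    induction k with
    | zero =>
      filter_upwards [Lp.coeFn_smul a f] with t ht
      rw [monomial_zero_left, aeval_C, Algebra.algebraMap_eq_smul_one, eval_C]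
      exact ht
    | succ k ih =>
      filter_upwards [ih, coeFn_mulPt (aeval mulPt (monomial k a) f)] with t h1 h2
      rw [← X_mul_monomial, map_mul, aeval_X, eval_mul, eval_X, mul_assoc, ← h1]
      exact h2

theorem mulPt_fourierBasis (n : ℤ) : mulPt (fourierBasis n) = fourierBasis (n + 1) := by
  rw [coe_fourierBasis]
  apply Lp.ext
  filter_upwards [coeFn_mulPt (fourierLp 2 n), coeFn_fourierLp 2 n, coeFn_fourierLp 2 (n + 1)]
    with t h1 h2 h3
  rw [h1, h2, h3, fourier_add, fourier_one, mul_comm]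
  rfl

theorem star_mulPt_mul_mulPt : star mulPt * mulPt = 1 := by
  refine (ContinuousLinearMap.norm_map_iff_adjoint_comp_self mulPt).mp fun f => ?_
  rw [Lp.norm_def, Lp.norm_def]
  refine congrArg ENNReal.toReal (eLpNorm_congr_norm_ae ?_)
  filter_upwards [coeFn_mulPt f] with t ht
  rw [ht, norm_mul, pt, Circle.norm_coe, one_mul]

theorem inner_fourierBasis_mulPt (n : ℤ) (f : L2) :
    inner ℂ (fourierBasis (n + 1) : L2) (mulPt f) = inner ℂ (fourierBasis n : L2) f := by
  rw [← mulPt_fourierBasis, ← ContinuousLinearMap.adjoint_inner_right,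
    ← ContinuousLinearMap.star_eq_adjoint, ← mul_apply_eq_comp, star_mulPt_mul_mulPt,
    one_apply_eq_self]

theorem mem_H2_iff {f : L2} : f ∈ H2 ↔ ∀ n : ℤ, n < 0 → inner ℂ (fourierBasis n : L2) f = 0 := by
  simp only [← HilbertBasis.repr_apply_apply, fourierBasis_repr]
  rfl

theorem mulPt_mem_H2 {f : L2} (hf : f ∈ H2) : mulPt f ∈ H2 :=
  mem_H2_iff.mpr fun n hn => by
    rw [← sub_add_cancel n 1, inner_fourierBasis_mulPt]
    exact mem_H2_iff.mp hf _ (by omega)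

/-- The unilateral shift: multiplication by `z` on the Hardy space. -/
def shift : H2 →L[ℂ] H2 := mulPt.restrict fun _ => mulPt_mem_H2

theorem coe_aeval_shift (p : ℂ[X]) (x : H2) : (aeval shift p x : L2) = aeval mulPt p (x : L2) := by
  induction p using Polynomial.induction_on' with
  | add p r hp hr =>
    simp only [map_add, add_apply, Submodule.coe_add, hp, hr]
  | monomial k a =>
    induction k with
    | zero => simp [Algebra.algebraMap_eq_smul_one]
    | succ k ih =>
      rw [← X_mul_monomial, map_mul, map_mul, aeval_X, aeval_X, mul_apply_eq_comp,
        mul_apply_eq_comp, ← ih]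
      rfl

/-- The constant function `1` in `H²`. -/
def oneH2 : H2 :=
  ⟨fourierBasis 0, mem_H2_iff.mpr fun _ hn => fourierBasis.orthonormal.2 hn.ne⟩

theorem coeFn_oneH2 : ∀ᵐ t ∂𝔪, (oneH2 : L2) t = 1 := by
  have h : (oneH2 : L2) = fourierLp 2 0 := congrFun coe_fourierBasis 0
  filter_upwards [coeFn_fourierLp 2 0] with t ht
  rw [h, ht, fourier_zero]

theorem shift_pow_oneH2 (n : ℕ) : ((shift ^ n) oneH2 : L2) = fourierBasis n := by
  induction n with
  | zero => rfl
  | succ n ih =>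
    rw [pow_succ', mul_apply_eq_comp, Nat.cast_succ, ← mulPt_fourierBasis, ← ih]
    rfl

theorem eq_zero_of_inner_shift_pow_oneH2 {x : H2} (h : ∀ n, inner ℂ ((shift ^ n) oneH2) x = 0) :
    x = 0 := by
  refine Subtype.ext (fourierBasis.repr.injective (lp.ext (funext fun n => ?_)))
  rw [HilbertBasis.repr_apply_apply, Submodule.coe_zero, map_zero]
  obtain ⟨n, rfl⟩ | hn := (le_or_gt 0 n).imp_left Int.eq_ofNat_of_zero_le
  · exact shift_pow_oneH2 n ▸ h n
  · exact mem_H2_iff.mp x.2 n hn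

theorem star_shift_mul_shift : star shift * shift = 1 :=
  (ContinuousLinearMap.norm_map_iff_adjoint_comp_self shift).mp fun x =>
    (ContinuousLinearMap.norm_map_iff_adjoint_comp_self mulPt).mpr star_mulPt_mul_mulPt (x : L2)

theorem star_shift_oneH2 : star shift oneH2 = 0 := by
  refine eq_zero_of_inner_shift_pow_oneH2 fun n => ?_
  rw [ContinuousLinearMap.star_eq_adjoint, ContinuousLinearMap.adjoint_inner_right,
    ← mul_apply_eq_comp, ← pow_succ', Submodule.coe_inner, shift_pow_oneH2]
  exact fourierBasis.orthonormal.2 (by positivity)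

theorem norm_oneH2 : ‖oneH2‖ = 1 := fourierBasis.orthonormal.1 0

theorem isPureIsometry_shift : IsPureIsometry shift :=
  isPureIsometry_of_cyclic star_shift_oneH2 (fun _ => eq_zero_of_inner_shift_pow_oneH2)
    star_shift_mul_shift

theorem ker_star_shift : (star shift).ker = ℂ ∙ oneH2 :=
  ker_star_eq_span_of_cyclic star_shift_oneH2 (fun _ => eq_zero_of_inner_shift_pow_oneH2) norm_oneH2

theorem aeval_mulPt_mem_H2 (p : ℂ[X]) {f : L2} (hf : f ∈ H2) : aeval mulPt p f ∈ H2 :=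
  coe_aeval_shift p ⟨f, hf⟩ ▸ (aeval shift p ⟨f, hf⟩).2

theorem mem_H2_of_mulPt_sub_smul_mem_H2 {α : ℂ} (hα : ‖α‖ = 1) {f : L2}
    (hf : mulPt f - α • f ∈ H2) : f ∈ H2 := by
  refine mem_H2_iff.mpr fun n hn => norm_eq_zero.mp ?_
  have hrec (k : ℤ) (hk : k < 0) : ‖inner ℂ (fourierBasis (k - 1) : L2) f‖ =
      ‖inner ℂ (fourierBasis k : L2) f‖ := by
    have h := mem_H2_iff.mp hf k hk
    rw [inner_sub_right, inner_smul_right, sub_eq_zero, ← sub_add_cancel k 1,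
      inner_fourierBasis_mulPt, sub_add_cancel] at h
    rw [h, norm_mul, hα, one_mul]
  have hconst (k : ℕ) : ‖inner ℂ (fourierBasis (n - k) : L2) f‖ =
      ‖inner ℂ (fourierBasis n : L2) f‖ := by
    induction k with
    | zero => simp
    | succ k ih => rw [Nat.cast_succ, ← sub_sub, hrec _ (by omega), ih]
  have hinj : Function.Injective fun k : ℕ => n - (k : ℤ) := fun j k h => by simpa using h
  have hlim := ((fourierBasis.orthonormal.inner_products_summable (x := f)).comp_injective
    hinj).tendsto_atTop_zero
  simp only [Function.comp_def, hconst] at hlim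
  simpa using tendsto_nhds_unique tendsto_const_nhds hlim

theorem mem_H2_of_aeval_mulPt_mem_H2 {p : ℂ[X]} (hp : p ≠ 0) (hroots : ∀ z, p.IsRoot z → ‖z‖ = 1)
    {f : L2} (hf : aeval mulPt p f ∈ H2) : f ∈ H2 := by
  refine induction_on_roots (P := fun p => ∀ f, aeval mulPt p f ∈ H2 → f ∈ H2) hp
    (fun a ha f hf => ?_) (fun α r hα hr f hf => hr f ?_) f hf
  · rw [aeval_C, Algebra.algebraMap_eq_smul_one] at hf
    exact (Submodule.smul_mem_iff _ ha).mp hf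
  · refine mem_H2_of_mulPt_sub_smul_mem_H2 (hroots α hα) ?_
    rwa [map_mul, map_sub, aeval_X, aeval_C, Algebra.algebraMap_eq_smul_one] at hf

/-! ### The graph of a Toeplitz-like operator -/

theorem isPole_div_iff {s q : ℂ[X]} (hq : q ≠ 0) (hsq : IsCoprime s q) (z : ℂ) :
    IsPole (algebraMap ℂ[X] (RatFunc ℂ) s / algebraMap ℂ[X] (RatFunc ℂ) q) z ↔ q.IsRoot z := by
  have h := (RatFunc.num_mul_eq_mul_denom_iff (p := s) hq).mpr rfl
  exact ⟨fun hz => eval_eq_zero_of_dvd_of_eval_eq_zero (RatFunc.denom_div_dvd s q) hz, fun hz =>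
    eval_eq_zero_of_dvd_of_eval_eq_zero
      (hsq.symm.dvd_of_dvd_mul_left (Dvd.intro_left _ h)) hz⟩

theorem val_div {s q : ℂ[X]} {z : ℂ} (hz : q.eval z ≠ 0) :
    val (algebraMap ℂ[X] (RatFunc ℂ) s / algebraMap ℂ[X] (RatFunc ℂ) q) z =
      s.eval z / q.eval z := by
  have hq : q ≠ 0 := by
    rintro rfl
    exact hz eval_zero
  have hdenom : IsPole (algebraMap ℂ[X] (RatFunc ℂ) s / algebraMap ℂ[X] (RatFunc ℂ) q) z → False :=
    fun h => hz (eval_eq_zero_of_dvd_of_eval_eq_zero (RatFunc.denom_div_dvd s q) h)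
  have h := congrArg (Polynomial.eval z) ((RatFunc.num_mul_eq_mul_denom_iff (p := s) hq).mpr rfl)
  rw [eval_mul, eval_mul] at h
  rw [val, RatFunc.eval, eval₂_id, eval₂_id, div_eq_div_iff hdenom hz, h]

theorem ae_eval_ne_zero {q : ℂ[X]} (hq : q ≠ 0) : ∀ᵐ t ∂𝔪, q.eval (pt t) ≠ 0 := by
  filter_upwards [ae_not_isPole (algebraMap ℂ[X] (RatFunc ℂ) 1 / algebraMap ℂ[X] (RatFunc ℂ) q)]
    with t ht
  rwa [isPole_div_iff hq isCoprime_one_left] at ht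

theorem div_mem_Rat0T {p q : ℂ[X]} (hq : q ≠ 0) (hroots : ∀ z, q.IsRoot z → ‖z‖ = 1)
    (hp : p.degree < q.degree) :
    algebraMap ℂ[X] (RatFunc ℂ) p / algebraMap ℂ[X] (RatFunc ℂ) q ∈ Rat0T := by
  refine ⟨fun z hz => hroots z
    (eval_eq_zero_of_dvd_of_eval_eq_zero (RatFunc.denom_div_dvd p q) hz), ?_⟩
  rwa [strictlyProper_iff hq ((RatFunc.num_mul_eq_mul_denom_iff hq).mpr rfl).symm]

theorem ae_val_div_mul_eq_iff {s q p r : ℂ[X]} (hq : q ≠ 0) (hr : r ≠ 0) {f g : L2} :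
    (∀ᵐ t ∂𝔪, val (algebraMap ℂ[X] (RatFunc ℂ) s / algebraMap ℂ[X] (RatFunc ℂ) q) (pt t) * g t =
      f t + val (algebraMap ℂ[X] (RatFunc ℂ) p / algebraMap ℂ[X] (RatFunc ℂ) r) (pt t)) ↔
    aeval mulPt (r * s) g = aeval mulPt (r * q) f + aeval mulPt (q * p) (oneH2 : L2) := by
  rw [Lp.ext_iff]
  refine Filter.eventually_congr ?_
  filter_upwards [ae_eval_ne_zero hq, ae_eval_ne_zero hr, coeFn_aeval_mulPt (r * s) g,
    coeFn_aeval_mulPt (r * q) f, coeFn_aeval_mulPt (q * p) (oneH2 : L2), coeFn_oneH2,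
    Lp.coeFn_add (aeval mulPt (r * q) f) (aeval mulPt (q * p) (oneH2 : L2))]
    with t hqt hrt hg hf hp hone hadd
  rw [val_div hqt, val_div hrt, hg, hadd, Pi.add_apply, hf, hp, hone, eval_mul, eval_mul, eval_mul]
  field_simp

section ToeplitzGraph

variable {s q : ℂ[X]} (hq : q ≠ 0) (hroots : ∀ z, q.IsRoot z → ‖z‖ = 1) {x : H2 × H2}
include hq hroots

theorem mem_toeplitzGraph_of_star_shift_pow
    (h : (star shift ^ q.natDegree) (aeval shift s x.1 - aeval shift q x.2) = 0) :
    x ∈ toeplitzGraph (algebraMap ℂ[X] (RatFunc ℂ) s / algebraMap ℂ[X] (RatFunc ℂ) q) := by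
  obtain ⟨p, hp, hpx⟩ := (isPureIsometry_shift.star_pow_apply_eq_zero_iff ker_star_shift).mp h
  rw [← degree_eq_natDegree hq] at hp
  refine ⟨x.2, _, div_mem_Rat0T hq hroots hp, (ae_val_div_mul_eq_iff hq hq).mpr ?_,
    (H2.orthogonalProjectionOnto_mem_subspace_eq_self x.2).symm⟩
  rw [← coe_aeval_shift, ← coe_aeval_shift, ← coe_aeval_shift, ← Submodule.coe_add]
  refine congrArg Subtype.val ?_
  simp only [map_mul, mul_apply_eq_comp, hpx, ← map_add, add_sub_cancel]

theorem star_shift_pow_of_mem_toeplitzGraph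
    (h : x ∈ toeplitzGraph (algebraMap ℂ[X] (RatFunc ℂ) s / algebraMap ℂ[X] (RatFunc ℂ) q)) :
    (star shift ^ q.natDegree) (aeval shift s x.1 - aeval shift q x.2) = 0 := by
  obtain ⟨f, ρ, ⟨hpoles, hproper⟩, hf, hx⟩ := h
  have hr := ρ.denom_ne_zero
  rw [← RatFunc.num_div_denom ρ] at hf
  have hL2 := (ae_val_div_mul_eq_iff hq hr).mp hf
  have hfH2 : f ∈ H2 := by
    refine mem_H2_of_aeval_mulPt_mem_H2 (mul_ne_zero hr hq)
      (fun z hz => (root_mul.mp hz).elim (hpoles z) (hroots z)) ?_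
    rw [eq_sub_of_add_eq hL2.symm]
    exact sub_mem (aeval_mulPt_mem_H2 _ x.1.2) (aeval_mulPt_mem_H2 _ oneH2.2)
  obtain rfl : f = x.2 :=
    congrArg Subtype.val
      (hx.trans (H2.orthogonalProjectionOnto_mem_subspace_eq_self ⟨f, hfH2⟩)).symm
  have hH2 : aeval shift ρ.denom (aeval shift s x.1 - aeval shift q x.2) =
      aeval shift (q * ρ.num) oneH2 := by
    rw [map_sub, ← mul_apply_eq_comp, ← mul_apply_eq_comp, ← map_mul, ← map_mul, sub_eq_iff_eq_add']
    refine Subtype.ext ?_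
    simpa only [Submodule.coe_add, coe_aeval_shift] using hL2
  refine isPureIsometry_shift.star_pow_apply_eq_zero_of_aeval hr hpoles ?_
  refine (isPureIsometry_shift.star_pow_apply_eq_zero_iff ker_star_shift).mpr ⟨_, ?_, hH2.symm⟩
  rw [degree_mul, Nat.cast_add, degree_eq_natDegree hq, ← degree_eq_natDegree hr]
  exact WithBot.add_lt_add_left WithBot.coe_ne_bot hproper

theorem graph_toeplitz :
    (toeplitz (algebraMap ℂ[X] (RatFunc ℂ) s / algebraMap ℂ[X] (RatFunc ℂ) q)).graph =
      quotientGraph (star shift ^ q.natDegree * aeval shift s)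
        (star shift ^ q.natDegree * aeval shift q) := by
  ext x
  rw [mem_graph_toeplitz_iff, mem_quotientGraph, mul_apply_eq_comp, mul_apply_eq_comp,
    ← sub_eq_zero, ← map_sub]
  exact ⟨star_shift_pow_of_mem_toeplitzGraph hq hroots,
    mem_toeplitzGraph_of_star_shift_pow hq hroots⟩

end ToeplitzGraph

theorem oneH2_ne_zero : oneH2 ≠ 0 := by
  rw [← norm_ne_zero_iff, norm_oneH2]
  exact one_ne_zero

instance nontrivial_H2 : Nontrivial H2 :=
  nontrivial_of_ne oneH2 0 oneH2_ne_zero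

theorem div_mem_range_ofReal_iff {a b : ℂ} (hb : b ≠ 0) :
    a / b ∈ Set.range ((↑) : ℝ → ℂ) ↔ a * conj b = conj a * b := by
  have hb' : conj b ≠ 0 := star_ne_zero.mpr hb
  rw [eq_comm, ← div_eq_div_iff hb' hb, ← map_div₀, Complex.conj_eq_iff_real]
  exact exists_congr fun x => eq_comm

theorem circleImage_subset_iff {s q : ℂ[X]} (hq : q ≠ 0) (hsq : IsCoprime s q) :
    circleImage (algebraMap ℂ[X] (RatFunc ℂ) s / algebraMap ℂ[X] (RatFunc ℂ) q) ⊆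
      Set.range ((↑) : ℝ → ℂ) ↔ RealOnCircle s q := by
  refine ⟨fun h => realOnCircle_of_finite (finite_setOfPred_isRoot hq) fun z hz hqz => ?_, ?_⟩
  · rw [← div_mem_range_ofReal_iff hqz, ← val_div hqz]
    exact h ⟨z, hz, (isPole_div_iff hq hsq z).not.mpr hqz, rfl⟩
  · rintro h _ ⟨z, hz, hpole, rfl⟩
    have hqz : q.eval z ≠ 0 := (isPole_div_iff hq hsq z).not.mp hpole
    rw [val_div hqz, div_mem_range_ofReal_iff hqz]
    exact h z hz

theorem essSpectrum_toeplitz {s q : ℂ[X]} (hq : q ≠ 0) (hroots : ∀ z, q.IsRoot z → ‖z‖ = 1)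
    (hsq : IsCoprime s q) :
    essSpectrum (toeplitz (algebraMap ℂ[X] (RatFunc ℂ) s / algebraMap ℂ[X] (RatFunc ℂ) q)) =
      circleImage (algebraMap ℂ[X] (RatFunc ℂ) s / algebraMap ℂ[X] (RatFunc ℂ) q) := by
  have : FiniteDimensional ℂ (star shift).ker := ker_star_shift ▸ inferInstance
  have hker : (star shift).ker ≠ ⊥ := by
    rw [ker_star_shift, Ne, Submodule.span_singleton_eq_bot]
    exact oneH2_ne_zero
  ext c
  rw [isPureIsometry_shift.mem_essSpectrum_iff hker hsq (graph_toeplitz hq hroots)]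
  constructor
  · rintro ⟨z, hz, hc⟩
    have hqz : q.eval z ≠ 0 := fun h0 => by
      obtain ⟨a, b, hab⟩ := hsq
      simpa [hc, h0] using congrArg (eval z) hab
    exact ⟨z, hz, (isPole_div_iff hq hsq z).not.mpr hqz,
      by rw [val_div hqz, hc, mul_div_cancel_right₀ _ hqz]⟩
  · rintro ⟨z, hz, hpole, rfl⟩
    have hqz : q.eval z ≠ 0 := (isPole_div_iff hq hsq z).not.mp hpole
    exact ⟨z, hz, by rw [val_div hqz, div_mul_cancel₀ _ hqz]⟩

/-! ### The Cayley transform -/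

/-- The polynomial `(w + i) ^ N * p ((w - i) / (w + i))` in `w`, for `p` of degree at most `N`:
the pullback of `p` to the real line under the Cayley transform, cleared of denominators. -/
def cayleyPoly (N : ℕ) (p : ℂ[X]) : ℂ[X] :=
  ∑ k ∈ Finset.range (N + 1), C (p.coeff k) * (X - C Complex.I) ^ k * (X + C Complex.I) ^ (N - k)

theorem eval_cayleyPoly {N : ℕ} {p : ℂ[X]} (hp : p.natDegree ≤ N) {w : ℂ} (hw : w + Complex.I ≠ 0) :
    (cayleyPoly N p).eval w =
      (w + Complex.I) ^ N * p.eval ((w - Complex.I) / (w + Complex.I)) := by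
  rw [eval_eq_sum_range' (Nat.lt_succ_of_le hp), cayleyPoly, eval_finsetSum, Finset.mul_sum]
  refine Finset.sum_congr rfl fun k hk => ?_
  simp only [eval_mul, eval_C, eval_pow, eval_sub, eval_add, eval_X, div_pow]
  rw [← pow_sub_mul_pow (w + Complex.I) (Finset.mem_range_succ_iff.mp hk)]
  field_simp

theorem eval_cayleyPoly_neg_I (N : ℕ) (p : ℂ[X]) :
    (cayleyPoly N p).eval (-Complex.I) = p.coeff N * (-2 * Complex.I) ^ N := by
  rw [cayleyPoly, eval_finsetSum, Finset.sum_range_succ, Finset.sum_eq_zero, zero_add]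
  · simp only [eval_mul, eval_C, eval_pow, eval_sub, eval_X, Nat.sub_self, pow_zero, mul_one]
    ring
  · intro k hk
    simp [Nat.sub_ne_zero_of_lt (Finset.mem_range.mp hk)]

theorem im_eq_zero_of_norm_cayley {w : ℂ} (hw : w + Complex.I ≠ 0)
    (h : ‖(w - Complex.I) / (w + Complex.I)‖ = 1) : w.im = 0 := by
  rw [norm_div, div_eq_one_iff_eq (norm_ne_zero_iff.mpr hw), ← sq_eq_sq₀ (norm_nonneg _)
    (norm_nonneg _), ← Complex.normSq_eq_norm_sq, ← Complex.normSq_eq_norm_sq] at h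
  simp only [Complex.normSq_apply, Complex.sub_re, Complex.sub_im, Complex.add_re, Complex.add_im,
    Complex.I_re, Complex.I_im] at h
  linarith

theorem im_eq_zero_of_eval_cayleyPoly_eq_zero {p : ℂ[X]} (hp : p ≠ 0)
    (hroots : ∀ z, p.IsRoot z → ‖z‖ = 1) {w : ℂ} (hw : (cayleyPoly p.natDegree p).eval w = 0) :
    w.im = 0 := by
  by_cases hwI : w + Complex.I = 0
  · rw [eq_neg_of_add_eq_zero_left hwI, eval_cayleyPoly_neg_I] at hw
    simp [hp] at hw
  · rw [eval_cayleyPoly le_rfl hwI] at hw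
    exact im_eq_zero_of_norm_cayley hwI
      (hroots _ ((mul_eq_zero.mp hw).resolve_left (pow_ne_zero _ hwI)))

theorem ofReal_add_I_ne_zero (x : ℝ) : (x : ℂ) + Complex.I ≠ 0 := fun h => by
  simpa using congrArg Complex.im h

theorem norm_cayley_ofReal (x : ℝ) : ‖((x : ℂ) - Complex.I) / (x + Complex.I)‖ = 1 := by
  have h : (x : ℂ) - Complex.I = conj ((x : ℂ) + Complex.I) := by simp [sub_eq_add_neg]
  rw [norm_div, h, Complex.norm_conj, div_self (norm_ne_zero_iff.mpr (ofReal_add_I_ne_zero x))]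

theorem invCayley_add_I_ne_zero {z : ℂ} (hz : z ≠ 1) : invCayley z + Complex.I ≠ 0 := by
  have hz' : z - 1 ≠ 0 := sub_ne_zero.mpr hz
  have h : invCayley z + Complex.I = -2 * Complex.I / (z - 1) := by
    rw [invCayley]
    field_simp
    ring
  rw [h]
  exact div_ne_zero (by simp) hz'

theorem cayley_invCayley {z : ℂ} (hz : z ≠ 1) :
    (invCayley z - Complex.I) / (invCayley z + Complex.I) = z := by
  have hz' : z - 1 ≠ 0 := sub_ne_zero.mpr hz
  rw [div_eq_iff (invCayley_add_I_ne_zero hz), invCayley]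
  field_simp
  ring

theorem exists_ofReal_eq_invCayley {z : ℂ} (hz : ‖z‖ = 1) (hz1 : z ≠ 1) :
    ∃ x : ℝ, (x : ℂ) = invCayley z := by
  have him :=
    im_eq_zero_of_norm_cayley (invCayley_add_I_ne_zero hz1) (by rwa [cayley_invCayley hz1])
  exact ⟨_, Complex.conj_eq_iff_re.mp (Complex.conj_eq_iff_im.mpr him)⟩

theorem eval_map_conj (p : ℂ[X]) (w : ℂ) :
    (p.map (starRingEnd ℂ)).eval w = conj (p.eval (conj w)) := by
  rw [← eval_map_apply, Complex.conj_conj]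

theorem exists_real_polynomial {p : ℂ[X]} (h : ∀ x : ℝ, conj (p.eval (x : ℂ)) = p.eval (x : ℂ)) :
    ∃ a : ℝ[X], a.map (algebraMap ℝ ℂ) = p := by
  have hconj : p.map (starRingEnd ℂ) = p := by
    refine eq_of_infinite_eval_eq _ _ ((Set.infinite_range_of_injective
      Complex.ofReal_injective).mono ?_)
    rintro _ ⟨x, rfl⟩
    rw [Set.mem_ofPred_eq, eval_map_conj, Complex.conj_ofReal, h]
  refine (mem_lifts p).mp ((lifts_iff_coeff_lifts p).mpr fun n => ?_)
  obtain ⟨x, hx⟩ := Complex.conj_eq_iff_real.mp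
    ((coeff_map _ n).symm.trans (congrArg (coeff · n) hconj))
  exact ⟨x, hx.symm⟩

theorem eval_algebraMap_div {K L : Type _} [Field K] [Field L] [Algebra K L] {a b : K[X]} {w : L}
    (hw : b.aeval w ≠ 0) :
    (algebraMap K[X] (RatFunc K) a / algebraMap K[X] (RatFunc K) b).eval (algebraMap K L) w =
      a.aeval w / b.aeval w := by
  have hb : b ≠ 0 := by
    rintro rfl
    exact hw (map_zero _)
  have hdenom : aeval w (algebraMap K[X] (RatFunc K) a / algebraMap K[X] (RatFunc K) b).denom ≠ 0 :=
    fun h => hw (aeval_eq_zero_of_dvd_aeval_eq_zero (RatFunc.denom_div_dvd a b) h)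
  have h := congrArg (aeval w) ((RatFunc.num_mul_eq_mul_denom_iff (p := a) hb).mpr rfl)
  rw [map_mul, map_mul] at h
  rw [RatFunc.eval, ← aeval_def, ← aeval_def, div_eq_div_iff hdenom hw, h]

theorem exists_real_ratFunc_of_real_on_line {p q : ℂ[X]}
    (hroots : ∀ w, q.eval w = 0 → w.im = 0)
    (h : ∀ x : ℝ, p.eval (x : ℂ) * conj (q.eval (x : ℂ)) =
      conj (p.eval (x : ℂ)) * q.eval (x : ℂ)) :
    ∃ τ : RatFunc ℝ, PolesOnReal τ ∧ ∀ w : ℂ, q.eval w ≠ 0 →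
      τ.eval (algebraMap ℝ ℂ) w = p.eval w / q.eval w := by
  have hconj {w : ℂ} (hw : conj (q.eval (conj w)) = 0) : w.im = 0 := by
    simpa using hroots _ (star_eq_zero.mp hw)
  -- Multiplying the numerator and the denominator by the conjugate of `q` makes both real.
  obtain ⟨a, ha⟩ := exists_real_polynomial (p := p * q.map (starRingEnd ℂ)) fun x => by
    rw [eval_mul, eval_map_conj, Complex.conj_ofReal, map_mul, Complex.conj_conj, h]
  obtain ⟨b, hb⟩ := exists_real_polynomial (p := q * q.map (starRingEnd ℂ)) fun x => by
    rw [eval_mul, eval_map_conj, Complex.conj_ofReal, map_mul, Complex.conj_conj, mul_comm]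
  have haeval (w : ℂ) : a.aeval w = p.eval w * conj (q.eval (conj w)) := by
    rw [← eval_map_conj, ← eval_mul, ← ha, eval_map_algebraMap]
  have hbeval (w : ℂ) : b.aeval w = q.eval w * conj (q.eval (conj w)) := by
    rw [← eval_map_conj, ← eval_mul, ← hb, eval_map_algebraMap]
  refine ⟨algebraMap ℝ[X] (RatFunc ℝ) a / algebraMap ℝ[X] (RatFunc ℝ) b, fun w hw => ?_,
    fun w hw => ?_⟩
  · have hbw := aeval_eq_zero_of_dvd_aeval_eq_zero (RatFunc.denom_div_dvd a b) hw
    rw [hbeval] at hbw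
    exact (mul_eq_zero.mp hbw).elim (hroots w) hconj
  · have hqw : conj (q.eval (conj w)) ≠ 0 := fun h0 => hw (by
      rwa [Complex.conj_eq_iff_im.mpr (hconj h0), map_eq_zero] at h0)
    rw [eval_algebraMap_div (hbeval w ▸ mul_ne_zero hw hqw), haeval, hbeval,
      mul_div_mul_right _ _ hqw]

theorem RealOnCircle.exists_eqCompInvCayley {s q : ℂ[X]} (h : RealOnCircle s q) (hq : q ≠ 0)
    (hroots : ∀ z, q.IsRoot z → ‖z‖ = 1) (hsq : IsCoprime s q) :
    ∃ τ : RatFunc ℝ, PolesOnReal τ ∧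
      EqCompInvCayley (algebraMap ℂ[X] (RatFunc ℂ) s / algebraMap ℂ[X] (RatFunc ℂ) q) τ := by
  have hdeg : s.natDegree ≤ q.natDegree := h.natDegree_le hq hroots
  obtain ⟨τ, hpoles, hτ⟩ := exists_real_ratFunc_of_real_on_line
    (p := cayleyPoly q.natDegree s) (q := cayleyPoly q.natDegree q)
    (fun w => im_eq_zero_of_eval_cayleyPoly_eq_zero hq hroots) fun x => by
      rw [eval_cayleyPoly hdeg (ofReal_add_I_ne_zero x),
        eval_cayleyPoly le_rfl (ofReal_add_I_ne_zero x), map_mul, map_mul,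
        mul_mul_mul_comm, h _ (norm_cayley_ofReal x)]
      ring
  refine ⟨τ, hpoles, fun z hz1 hpole _ => ?_⟩
  have hqz : q.eval z ≠ 0 := (isPole_div_iff hq hsq z).not.mp hpole
  have hwI := pow_ne_zero q.natDegree (invCayley_add_I_ne_zero hz1)
  have heval {p : ℂ[X]} (hp : p.natDegree ≤ q.natDegree) :
      (cayleyPoly q.natDegree p).eval (invCayley z) =
        (invCayley z + Complex.I) ^ q.natDegree * p.eval z := by
    rw [eval_cayleyPoly hp (invCayley_add_I_ne_zero hz1), cayley_invCayley hz1]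
  rw [hτ _ (heval le_rfl ▸ mul_ne_zero hwI hqz), heval hdeg, heval le_rfl,
    mul_div_mul_left _ _ hwI, val_div hqz]

theorem realOnCircle_of_eqCompInvCayley {s q : ℂ[X]} (hq : q ≠ 0) (hsq : IsCoprime s q)
    {τ : RatFunc ℝ}
    (h : EqCompInvCayley (algebraMap ℂ[X] (RatFunc ℂ) s / algebraMap ℂ[X] (RatFunc ℂ) q) τ) :
    RealOnCircle s q := by
  have hpoles : {w : ℂ | τ.denom.aeval w = 0}.Finite := by
    simpa only [IsRoot.def, eval_map_algebraMap] using
      finite_setOfPred_isRoot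
        ((Polynomial.map_ne_zero_iff (algebraMap ℝ ℂ).injective).mpr τ.denom_ne_zero)
  refine realOnCircle_of_finite (((finite_setOfPred_isRoot hq).union
    (hpoles.image fun w => (w - Complex.I) / (w + Complex.I))).insert 1) fun z hz hF => ?_
  simp only [Set.mem_insert_iff, Set.mem_union, not_or] at hF
  obtain ⟨hz1, hqz, hτz⟩ := hF
  have hval := h z hz1 ((isPole_div_iff hq hsq z).not.mpr hqz)
    fun h0 => hτz ⟨_, h0, cayley_invCayley hz1⟩
  obtain ⟨x, hx⟩ := exists_ofReal_eq_invCayley hz hz1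
  rw [← div_mem_range_ofReal_iff hqz, ← val_div hqz, hval, ← hx, RatFunc.eval,
    ← Complex.coe_algebraMap, eval₂_at_apply, eval₂_at_apply, ← map_div₀]
  exact Set.mem_range_self _

end ToeplitzLike

end

theorem theorem5p1 (ω : RatFunc ℂ) (hω : ω ∈ RatT) (s q : ℂ[X]) (hq : q ≠ 0)
    (hsq : IsCoprime s q)
    (hωsq : ω = algebraMap ℂ[X] (RatFunc ℂ) s / algebraMap ℂ[X] (RatFunc ℂ) q) :
    [ IsSymmetricOp (toeplitz ω).adjoint,
      circleImage ω ⊆ Set.range ((↑) : ℝ → ℂ),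
      ∃ τ : RatFunc ℝ, PolesOnReal τ ∧ EqCompInvCayley ω τ,
      essSpectrum (toeplitz ω) ⊆ Set.range ((↑) : ℝ → ℂ),
      s = 0 ∨ (s.natDegree ≤ q.natDegree ∧
        (∃ r : ℂ[X], SelfInversive r ∧ s = X ^ (q.natDegree - s.natDegree) * r) ∧
        q.coeff 0 * conj (s.coeff s.natDegree) =
          conj (q.coeff q.natDegree) * s.coeff (q.natDegree - s.natDegree)) ].TFAE ∧
    (IsSymmetricOp (toeplitz ω).adjoint → (toeplitz ω).adjoint ≤ toeplitz ω) := by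
  subst hωsq
  have hroots (z : ℂ) (hz : q.IsRoot z) : ‖z‖ = 1 := hω z ((isPole_div_iff hq hsq z).mpr hz)
  have hA := graph_toeplitz (s := s) hq hroots
  have hsymm := isPureIsometry_shift.isSymmetricOp_adjoint_iff_realOnCircle hq hroots hA
  refine ⟨?_, fun h => isPureIsometry_shift.adjoint_le_of_realOnCircle hq hroots hA (hsymm.mp h)⟩
  rw [hsymm, essSpectrum_toeplitz hq hroots hsq, circleImage_subset_iff hq hsq,
    ← realOnCircle_iff_selfInversive hq hroots]
  tfae_have 1 ↔ 2 := Iff.rfl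
  tfae_have 2 ↔ 4 := Iff.rfl
  tfae_have 2 ↔ 5 := Iff.rfl
  tfae_have 2 → 3 := fun h => h.exists_eqCompInvCayley hq hroots hsq
  tfae_have 3 → 2 := fun ⟨_, _, h⟩ => realOnCircle_of_eqCompInvCayley hq hsq h
  tfae_finish
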